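/- Let $d\ge 1$ and let $\{X_{nj}: n\in\mathbb N,\ j\in\mathbb Z^d\}$ be real random variables with mean zero on a probability space $(\Omega,\mathcal F,P)$ such that, for each $n$, the variables $X_{nj}$, $j\in\mathbb Z^d$, are independent. For each $n$ let $H_n>0$ be such that, for every $j$, $\mathbb E e^{zX_{nj}}$ is finite for all complex $|z|<H_n$ and the cumulant generating function $L_{nj}(z)=\log \mathbb E e^{zX_{nj}}$ (the logarithm normalised by $L_{nj}(0)=0$) is analytic in the disc $|z|<H_n$. Let $\gamma_{3nj}$ be the third cumulant of $X_{nj}$, i.e. the third derivative of $L_{nj}$ at $0$. Put $$S_n=\sum_{j\in\mathbb Z^d}X_{nj},\qquad B_n=\sum_{j\in\mathbb Z^d}\mathbb E X_{nj}^2,\qquad F_n(x)=P\big(S_n<x\sqrt{B_n}\big),$$ where $B_n<\infty$ for each $n$ and $S_n$ is the limit in probability, as $m\to\infty$, of the partial sums over $[-m,m]^d\cap\mathbb Z^d$. Let $\Phi$ be the standard normal distribution function. Suppose that there are constants $c_{nj}\ge 0$ with $|L_{nj}(z)|\le c_{nj}$ for all $n$, $j$ and all complex $|z|<H_n$, that $C_n:=\sum_{j\in\mathbb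 Z^d}c_{nj}<\infty$ for each $n$, and that, as $n\to\infty$, $B_nH_n^2\to\infty$ and $C_n=O(B_nH_n^2)$. Suppose moreover that $\sum_{j\in\mathbb Z^d}\gamma_{3nj}=0$ for all $n$. Then, for $x\ge 0$ with $x=O\big((H_n\sqrt{B_n})^{1/3}\big)$, $$F_n(x)-\Phi(x)=O\Big(\frac{e^{-x^2/2}}{H_n\sqrt{B_n}}\Big)\qquad (n\to\infty),$$ that is: for every $K$ there are $C$ and $N$ such that for all $n\ge N$ and all $x$ with $0\le x\le K(H_n\sqrt{B_n})^{1/3}$, $$|F_n(x)-\Phi(x)|\le C\,\frac{e^{-x^2/2}}{H_n\sqrt{B_n}}.$$ -/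

import Mathlib

open MeasureTheory ProbabilityTheory Filter Topology

noncomputable section

/-- `L` is the complex cumulant generating function `z ↦ log 𝔼 exp (z Y)` of the random variable `Y`
on the disc `|z| < r`: the exponential moments are finite there, and `L` is the analytic
logarithm of `𝔼 exp (z Y)` normalised by `L 0 = 0`. These properties determine `L` uniquely on
the disc. -/
structure IsComplexCGF {Ω : Type*} [MeasurableSpace Ω] (P : Measure Ω) (Y : Ω → ℝ) (r : ℝ)
    (L : ℂ → ℂ) : Prop where
  integrable_exp : ∀ z ∈ Metric.ball (0 : ℂ) r, Integrable (fun ω => Complex.exp (z * Y ω)) P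
  analytic : AnalyticOnNhd ℂ L (Metric.ball (0 : ℂ) r)
  map_zero : L 0 = 0
  exp_eq : ∀ z ∈ Metric.ball (0 : ℂ) r, Complex.exp (L z) = complexMGF Y P z

/-- The cumulant of order `k` of `Y`: the `k`-th derivative at `0` of `t ↦ log 𝔼 exp (t Y)`. -/
def cumulant {Ω : Type*} [MeasurableSpace Ω] (P : Measure Ω) (Y : Ω → ℝ) (k : ℕ) : ℝ :=
  iteratedDeriv k (cgf Y P) 0

/-- The lattice cube `[-m, m]^d ∩ ℤ^d`. -/
def latticeCube (d m : ℕ) : Finset (Fin d → ℤ) :=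
  Finset.Icc (fun _ => -(m : ℤ)) (fun _ => (m : ℤ))

/-- `S` is the sum `∑_{j ∈ ℤ^d} Y j`, the limit in probability of the partial sums over the
lattice cubes `[-m, m]^d ∩ ℤ^d` as `m → ∞`. -/
def IsFieldSum {Ω : Type*} [MeasurableSpace Ω] (P : Measure Ω) {d : ℕ}
    (Y : (Fin d → ℤ) → Ω → ℝ) (S : Ω → ℝ) : Prop :=
  TendstoInMeasure P (fun (m : ℕ) ω => ∑ j ∈ latticeCube d m, Y j ω) atTop S

/-- The sum of the variances `∑_{j ∈ ℤ^d} Var (Y j)`. -/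
def fieldVariance {Ω : Type*} [MeasurableSpace Ω] (P : Measure Ω) {d : ℕ}
    (Y : (Fin d → ℤ) → Ω → ℝ) : ℝ :=
  ∑' j, Var[Y j; P]

/-- The left-continuous distribution function `x ↦ P (S < x √B)`. -/
def normalizedCDF {Ω : Type*} [MeasurableSpace Ω] (P : Measure Ω) (S : Ω → ℝ) (B x : ℝ) : ℝ :=
  P.real {ω | S ω < x * √B}

/-- The standard normal distribution function `Φ`. -/
def stdNormalCDF (x : ℝ) : ℝ := cdf (gaussianReal 0 1) x

end

/-! By Cramér's tilting identity, the tail `P (Y ≥ x)` of the normalised sum `Y` equals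
`𝔼 exp (x Y) * exp (-x ^ 2)` times the integral of `exp (-x v)` over `v ≥ 0` against the law of
`Y - x` under the measure tilted by `exp (x Y)`, and the standard normal law is a fixed point of
this tilting. It therefore suffices to compare `𝔼 exp (x Y)` with `exp (x ^ 2 / 2)` and the tilted
law with the standard normal law, both up to `O(1 / T)` where `T = H √B`.

Both comparisons rest on the Schwarz lemma. The cumulant generating function of `Y` is `O(T ^ 2)` on
the disc of radius `T` and its first three cumulants are `0`, `1`, `0`, so it differs from
`z ^ 2 / 2` by `O(|z| ^ 4 / T ^ 2)`, with derivative `O(|z| ^ 3 / T ^ 2)`; for `x = O(T ^ (1 / 3))`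
the first bound is `O(x / T)`. The extra factor `x` is absorbed by the Laplace integral, which is
`O(1 / x)`. The second bound makes the characteristic function of the tilted law Gaussian up to
`O(|t| (1 + t ^ 2) / T)` for `|t| ≤ ε T`, and Esseen's smoothing inequality, obtained here from the
Fejér kernel, turns this into the bound on the distribution functions.
-/

section Smoothing

variable {κ μ ν : Measure ℝ} [IsProbabilityMeasure κ] [IsProbabilityMeasure μ]
  [IsProbabilityMeasure ν]

theorem measureReal_conv_eq_integral {M : Type*} [AddMonoid M] [MeasurableSpace M]
    [MeasurableAdd₂ M] (κ μ : Measure M) [IsFiniteMeasure μ] {s : Set M} (hs : MeasurableSet s) :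
    (κ ∗ μ).real s = ∫ v, μ.real ((v + ·) ⁻¹' s) ∂κ := by
  have hpre : MeasurableSet ((fun p : M × M => p.1 + p.2) ⁻¹' s) := measurable_add hs
  rw [measureReal_def, Measure.conv, Measure.map_apply measurable_add hs,
    Measure.prod_apply hpre]
  exact (integral_toReal (measurable_measure_prodMk_left hpre).aemeasurable
    (.of_forall fun v => measure_lt_top μ _)).symm

theorem cdf_conv_eq_integral (κ μ : Measure ℝ) [IsProbabilityMeasure κ] [IsProbabilityMeasure μ]
    (b : ℝ) : cdf (κ ∗ μ) b = ∫ v, cdf μ (b - v) ∂κ := by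
  simp only [cdf_eq_real, measureReal_conv_eq_integral κ μ measurableSet_Iic,
    Set.preimage_const_add_Iic]

theorem measureReal_Ioc_eq_cdf_sub (μ : Measure ℝ) [IsProbabilityMeasure μ] {a b : ℝ}
    (hab : a ≤ b) : μ.real (Set.Ioc a b) = cdf μ b - cdf μ a := by
  rw [cdf_eq_real, cdf_eq_real, ← Set.Iic_sdiff_Iic,
    measureReal_sdiff (Set.Iic_subset_Iic.2 hab) measurableSet_Iic]

theorem abs_cdf_sub_cdf_le_one (μ ν : Measure ℝ) (x : ℝ) : |cdf μ x - cdf ν x| ≤ 1 :=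
  abs_sub_le_of_nonneg_of_le (cdf_nonneg μ x) (cdf_le_one μ x) (cdf_nonneg ν x) (cdf_le_one ν x)

theorem abs_cdf_sub_cdf_le_of_Ioc {ε : ℝ}
    (h : ∀ a b, a ≤ b → |μ.real (Set.Ioc a b) - ν.real (Set.Ioc a b)| ≤ ε) (b : ℝ) :
    |cdf μ b - cdf ν b| ≤ ε := by
  have hlim : Tendsto (fun a => |(cdf μ b - cdf μ a) - (cdf ν b - cdf ν a)|) atBot
      (𝓝 |(cdf μ b - 0) - (cdf ν b - 0)|) :=
    (((tendsto_cdf_atBot μ).const_sub _).sub ((tendsto_cdf_atBot ν).const_sub _)).abs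
  simp only [sub_zero] at hlim
  refine le_of_tendsto hlim ?_
  filter_upwards [eventually_le_atBot b] with a hab
  rw [← measureReal_Ioc_eq_cdf_sub μ hab, ← measureReal_Ioc_eq_cdf_sub ν hab]
  exact h a b hab

theorem exists_le_measureReal_Icc_neg (κ : Measure ℝ) [IsProbabilityMeasure κ] {r : ℝ}
    (hr : r < 1) : ∃ η, r ≤ κ.real (Set.Icc (-η) η) := by
  have hlim : Tendsto (fun η : ℝ => κ.real (Set.Icc (-η) η)) atTop (𝓝 1) := by
    have := tendsto_measure_iUnion_atTop (μ := κ) (s := fun η : ℝ => Set.Icc (-η) η)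
      fun a b hab => Set.Icc_subset_Icc (neg_le_neg hab) hab
    rw [Set.iUnion_eq_univ_iff.2 fun x => ⟨|x|, abs_le.1 le_rfl⟩, measure_univ] at this
    simpa [measureReal_def, Function.comp_def] using
      (ENNReal.tendsto_toReal ENNReal.one_ne_top).comp this
  exact (hlim.eventually_const_le hr).exists

theorem le_of_integral_comp_sub_le {D : ℝ → ℝ} {m Δ ε η x : ℝ} (hm : 0 ≤ m)
    (hκ : 3 / 4 ≤ κ.real (Set.Icc (-η) η)) (hD : Measurable D) (hΔ : ∀ y, |D y| ≤ Δ)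
    (hmono : ∀ y, x ≤ y → D x - m * (y - x) ≤ D y) (hε : ∫ v, D (x + η - v) ∂κ ≤ ε) :
    D x ≤ 2 * m * η + 4 / 3 * ε + Δ / 3 := by
  have hbound (v : ℝ) : (Set.Icc (-η) η).indicator (fun _ => D x - 2 * m * η + Δ) v - Δ
      ≤ D (x + η - v) := by
    by_cases hv : v ∈ Set.Icc (-η) η
    · rw [Set.indicator_of_mem hv]
      have := hmono (x + η - v) (by linarith [hv.2])
      nlinarith [hv.1]
    · rw [Set.indicator_of_notMem hv]
      linarith [(abs_le.1 (hΔ (x + η - v))).1]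
  have hint : Integrable (fun v => D (x + η - v)) κ :=
    .of_bound (hD.comp (measurable_const.sub measurable_id)).aestronglyMeasurable Δ
      (.of_forall fun v => hΔ _)
  have hind : Integrable ((Set.Icc (-η) η).indicator fun _ => D x - 2 * m * η + Δ) κ :=
    (integrable_const _).indicator measurableSet_Icc
  have hle : κ.real (Set.Icc (-η) η) * (D x - 2 * m * η + Δ) - Δ ≤ ε := by
    refine le_trans (le_of_eq ?_)
      ((integral_mono (hind.sub (integrable_const Δ)) hint hbound).trans hε)
    simp only [Pi.sub_apply]
    rw [integral_sub hind (integrable_const Δ)]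
    simp [integral_indicator_const _ measurableSet_Icc]
  have hΔε : -Δ ≤ ε := by
    refine le_trans ?_ hε
    simpa using integral_mono (integrable_const (-Δ)) hint fun v => (abs_le.1 (hΔ (x + η - v))).1
  rcases le_total 0 (D x - 2 * m * η + Δ) with h | h
  · nlinarith
  · linarith

theorem abs_le_of_abs_integral_comp_sub_le {D : ℝ → ℝ} {m ε η : ℝ} (hm : 0 ≤ m)
    (hκ : 3 / 4 ≤ κ.real (Set.Icc (-η) η)) (hD : Measurable D) (hbdd : ∃ Δ, ∀ y, |D y| ≤ Δ)
    (hmono : ∀ x y, x ≤ y → D x - m * (y - x) ≤ D y) (hε : ∀ b, |∫ v, D (b - v) ∂κ| ≤ ε) (x : ℝ) :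
    |D x| ≤ 3 * m * η + 2 * ε := by
  have hself {Δ : ℝ} (hΔ : ∀ y, |D y| ≤ Δ) (y : ℝ) :
      |D y| ≤ 2 * m * η + 4 / 3 * ε + Δ / 3 := by
    refine abs_le'.2 ⟨le_of_integral_comp_sub_le hm hκ hD hΔ (hmono y) (abs_le.1 (hε _)).2, ?_⟩
    have : IsProbabilityMeasure (κ.map Neg.neg) :=
      Measure.isProbabilityMeasure_map measurable_neg.aemeasurable
    have hreflect := le_of_integral_comp_sub_le (κ := κ.map Neg.neg) (D := fun z => -D (-z))
      (ε := ε) (η := η) (x := -y) hm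
      (by rwa [map_measureReal_apply measurable_neg measurableSet_Icc, Set.neg_preimage,
        Set.neg_Icc, neg_neg])
      (hD.comp measurable_neg).neg (fun z => by simpa using hΔ (-z))
      (fun z hz => by rw [neg_neg]; linarith [hmono (-z) y (by linarith)]) ?_
    · simpa using hreflect
    · rw [integral_map measurable_neg.aemeasurable, integral_neg]
      · refine (neg_le_abs _).trans (le_of_eq_of_le ?_ (hε (y - η)))
        congr 3 with v
        ring_nf
      · exact (hD.comp (by fun_prop)).neg.aestronglyMeasurable
  obtain ⟨Δ, hΔ⟩ := hbdd
  have hrange : BddAbove (Set.range fun y => |D y|) := ⟨Δ, by rintro _ ⟨y, rfl⟩; exact hΔ y⟩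
  have hsup := ciSup_le (hself (le_ciSup hrange))
  linarith [le_ciSup hrange x]

theorem abs_cdf_sub_cdf_le_of_conv {m : NNReal} {ε η : ℝ}
    (hκ : 3 / 4 ≤ κ.real (Set.Icc (-η) η)) (hν : LipschitzWith m (cdf ν))
    (hε : ∀ b, |cdf (κ ∗ μ) b - cdf (κ ∗ ν) b| ≤ ε) (x : ℝ) :
    |cdf μ x - cdf ν x| ≤ 3 * m * η + 2 * ε := by
  have hint (ρ : Measure ℝ) [IsProbabilityMeasure ρ] (b : ℝ) :
      Integrable (fun v => cdf ρ (b - v)) κ :=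
    .of_bound ((monotone_cdf ρ).measurable.comp
      (measurable_const.sub measurable_id)).aestronglyMeasurable 1 (.of_forall fun v => by
        rw [Real.norm_of_nonneg (cdf_nonneg ρ _)]
        exact cdf_le_one ρ _)
  refine abs_le_of_abs_integral_comp_sub_le (D := fun y => cdf μ y - cdf ν y) m.coe_nonneg hκ
    ((monotone_cdf μ).measurable.sub (monotone_cdf ν).measurable)
    ⟨1, abs_cdf_sub_cdf_le_one μ ν⟩ ?_ ?_ x
  · intro a b hab
    have hlip := (le_abs_self _).trans (hν.dist_le_mul b a)
    rw [Real.dist_eq, abs_of_nonneg (sub_nonneg.2 hab)] at hlip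
    linarith [monotone_cdf μ hab]
  · intro b
    rw [integral_sub (hint μ b) (hint ν b), ← cdf_conv_eq_integral, ← cdf_conv_eq_integral]
    exact hε b

end Smoothing

section Fejer

/-- The Fejér kernel `u ↦ (sin (u / 2) / (u / 2)) ^ 2`, whose Fourier transform is a multiple of the
triangle function `t ↦ 1 - |t|` on `[-1, 1]` and vanishes elsewhere. -/
noncomputable def fejerKernel (u : ℝ) : ℝ := Real.sinc (u / 2) ^ 2

theorem continuous_fejerKernel : Continuous fejerKernel := by
  have := Real.continuous_sinc
  unfold fejerKernel
  fun_prop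

theorem fejerKernel_nonneg (u : ℝ) : 0 ≤ fejerKernel u := sq_nonneg _

theorem fejerKernel_le (u : ℝ) : fejerKernel u ≤ 5 * (1 + u ^ 2)⁻¹ := by
  have hle_one : fejerKernel u ≤ 1 := (sq_le_one_iff_abs_le_one _).2 (Real.abs_sinc_le_one _)
  have hdecay : fejerKernel u * u ^ 2 ≤ 4 := by
    rcases eq_or_ne u 0 with rfl | hu
    · simp
    · rw [fejerKernel, Real.sinc_of_ne_zero (by positivity)]
      field_simp
      nlinarith [Real.sin_sq_le_one (u / 2)]
  rw [← div_eq_mul_inv, le_div_iff₀ (by positivity)]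
  linarith

theorem integrable_fejerKernel : Integrable fejerKernel := by
  refine (integrable_inv_one_add_sq.const_mul 5).mono'
    continuous_fejerKernel.aestronglyMeasurable (.of_forall fun u => ?_)
  rw [Real.norm_of_nonneg (fejerKernel_nonneg u)]
  exact fejerKernel_le u

theorem integral_fejerKernel_pos : 0 < ∫ u, fejerKernel u :=
  integral_pos_of_integrable_nonneg_nonzero (x := 0) continuous_fejerKernel
    integrable_fejerKernel fejerKernel_nonneg (by simp [fejerKernel])

theorem integral_one_sub_mul_cos {u : ℝ} (hu : u ≠ 0) :
    ∫ t in (0 : ℝ)..1, (1 - t) * Real.cos (t * u) = (1 - Real.cos u) / u ^ 2 := by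
  have hderiv (t : ℝ) : HasDerivAt
      (fun t => (1 - t) * Real.sin (t * u) / u - Real.cos (t * u) / u ^ 2)
      ((1 - t) * Real.cos (t * u)) t := by
    have hmul := hasDerivAt_mul_const (x := t) u
    refine ((((hasDerivAt_id t).const_sub 1).mul hmul.sin).div_const u).sub
      (hmul.cos.div_const (u ^ 2)) |>.congr_deriv ?_
    simp only [id]
    field_simp
    ring
  rw [intervalIntegral.integral_eq_sub_of_hasDerivAt (fun t _ => hderiv t)
    ((by fun_prop : Continuous _).intervalIntegrable _ _)]
  simp only [sub_self, zero_mul, zero_div, one_mul, mul_zero, sub_zero, Real.sin_zero,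
    Real.cos_zero]
  ring

theorem fejerKernel_eq_integral_cos (u : ℝ) :
    fejerKernel u = 2 * ∫ t in (0 : ℝ)..1, (1 - t) * Real.cos (t * u) := by
  rcases eq_or_ne u 0 with rfl | hu
  · have htri : ∫ t in (0 : ℝ)..1, (1 - t) = 1 / 2 := by
      rw [intervalIntegral.integral_sub (by simp) (by simp), integral_id]
      norm_num
    simp [fejerKernel, htri]
  · have hcos : Real.cos u = 1 - 2 * Real.sin (u / 2) ^ 2 := by
      rw [← mul_div_cancel₀ u (two_ne_zero' ℝ), Real.cos_two_mul', Real.cos_sq']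
      ring_nf
    rw [integral_one_sub_mul_cos hu, fejerKernel, Real.sinc_of_ne_zero (by positivity), hcos]
    field_simp
    ring

theorem ofReal_fejerKernel_eq_integral (u : ℝ) :
    (fejerKernel u : ℂ)
      = ∫ t in (-1 : ℝ)..1, ((1 - |t| : ℝ) : ℂ) * Complex.exp (t * u * Complex.I) := by
  have hint (a b : ℝ) : IntervalIntegrable
      (fun t : ℝ => ((1 - |t| : ℝ) : ℂ) * Complex.exp (t * u * Complex.I)) volume a b :=
    (by fun_prop : Continuous _).intervalIntegrable a b
  have hfold : ∫ t in (-1 : ℝ)..0, ((1 - |t| : ℝ) : ℂ) * Complex.exp (t * u * Complex.I)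
      = ∫ t in (0 : ℝ)..1, ((1 - |t| : ℝ) : ℂ) * Complex.exp (-(t * u * Complex.I)) := by
    rw [← neg_zero, ← intervalIntegral.integral_comp_neg]
    simp
  have hint' : IntervalIntegrable
      (fun t : ℝ => ((1 - |t| : ℝ) : ℂ) * Complex.exp (-(t * u * Complex.I))) volume 0 1 :=
    (by fun_prop : Continuous _).intervalIntegrable 0 1
  rw [← intervalIntegral.integral_add_adjacent_intervals (hint (-1) 0) (hint 0 1), hfold,
    ← intervalIntegral.integral_add hint' (hint 0 1), fejerKernel_eq_integral_cos,
    ← intervalIntegral.integral_const_mul, ← intervalIntegral.integral_ofReal]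
  refine intervalIntegral.integral_congr fun t ht => ?_
  rw [Set.uIcc_of_le zero_le_one] at ht
  have hexp : 2 * Complex.cos (t * u)
      = Complex.exp (t * u * Complex.I) + Complex.exp (-(t * u * Complex.I)) := by
    rw [Complex.two_cos, neg_mul]
  simp only [abs_of_nonneg ht.1]
  push_cast
  linear_combination (1 - (t : ℂ)) * hexp

/-- The Fejér law, i.e. the probability measure on `ℝ` with density proportional to the Fejér
kernel. Its characteristic function vanishes outside `[-1, 1]`, so smoothing by it only sees
characteristic functions on that interval. -/
noncomputable def fejerMeasure : Measure ℝ :=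
  volume.withDensity fun u => ENNReal.ofReal (fejerKernel u / ∫ v, fejerKernel v)

theorem fejerMeasure_apply (s : Set ℝ) (hs : MeasurableSet s) :
    fejerMeasure s = ENNReal.ofReal ((∫ u in s, fejerKernel u) / ∫ u, fejerKernel u) := by
  have hpos := integral_fejerKernel_pos
  rw [fejerMeasure, withDensity_apply _ hs, ← ofReal_integral_eq_lintegral_ofReal
      (integrable_fejerKernel.div_const _).integrableOn
      (.of_forall fun u => div_nonneg (fejerKernel_nonneg u) hpos.le),
    integral_div]

instance : IsProbabilityMeasure fejerMeasure where
  measure_univ := by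
    rw [fejerMeasure_apply _ .univ, setIntegral_univ, div_self integral_fejerKernel_pos.ne',
      ENNReal.ofReal_one]

theorem measureReal_fejerMeasure_Ioc_sub {a b : ℝ} (hab : a ≤ b) (y : ℝ) :
    fejerMeasure.real (Set.Ioc (a - y) (b - y))
      = (∫ s in a..b, fejerKernel (s - y)) / ∫ u, fejerKernel u := by
  rw [measureReal_def, fejerMeasure_apply _ measurableSet_Ioc, ENNReal.toReal_ofReal,
    intervalIntegral.integral_comp_sub_right fejerKernel, intervalIntegral.integral_of_le
      (by linarith)]
  exact div_nonneg (integral_nonneg fejerKernel_nonneg) integral_fejerKernel_pos.le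

theorem norm_integral_exp_neg_mul_I_le (a b : ℝ) {t : ℝ} (ht : t ≠ 0) :
    ‖∫ s in a..b, Complex.exp (-(t * s * Complex.I))‖ ≤ 2 / |t| := by
  have hne : (-(t * Complex.I) : ℂ) ≠ 0 := by simp [ht]
  have hunit (s : ℝ) : ‖Complex.exp (-(t * Complex.I) * s)‖ = 1 := by
    rw [Complex.norm_exp]
    simp
  calc ‖∫ s in a..b, Complex.exp (-(t * s * Complex.I))‖
      = ‖∫ s in a..b, Complex.exp (-(t * Complex.I) * s)‖ := by
        congr! 4 with s
        ring
    _ = ‖Complex.exp (-(t * Complex.I) * b) - Complex.exp (-(t * Complex.I) * a)‖ / |t| := by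
        rw [integral_exp_mul_complex hne, norm_div]
        simp
    _ ≤ 2 / |t| := by
        gcongr
        refine (norm_sub_le _ _).trans ?_
        rw [hunit, hunit]
        norm_num

theorem integral_fejerKernel_sub_eq (a b y : ℝ) :
    ((∫ s in a..b, fejerKernel (s - y) : ℝ) : ℂ) = ∫ t in (-1 : ℝ)..1,
      ((1 - |t| : ℝ) : ℂ) * Complex.exp (t * y * Complex.I)
        * ∫ s in a..b, Complex.exp (-(t * s * Complex.I)) := by
  have hcont : Continuous (Function.uncurry fun s t : ℝ =>
      ((1 - |t| : ℝ) : ℂ) * Complex.exp (t * y * Complex.I)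
        * Complex.exp (-(t * s * Complex.I))) := by fun_prop
  have heven (s : ℝ) : fejerKernel (s - y) = fejerKernel (y - s) := by
    rw [fejerKernel, fejerKernel, ← Real.sinc_neg]
    ring_nf
  simp_rw [← intervalIntegral.integral_const_mul]
  rw [← intervalIntegral_intervalIntegral_swap, ← intervalIntegral.integral_ofReal]
  · congr! 2 with s
    rw [heven, ofReal_fejerKernel_eq_integral]
    congr! 2 with t
    rw [mul_assoc _ (Complex.exp _) (Complex.exp _), ← Complex.exp_add]
    push_cast
    ring_nf
  · exact (hcont.continuousOn.integrableOn_compact (isCompact_uIcc.prod isCompact_uIcc)).mono_set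
      (Set.prod_mono Set.uIoc_subset_uIcc Set.uIoc_subset_uIcc)

theorem measureReal_fejerMeasure_conv_Ioc (μ : Measure ℝ) [IsProbabilityMeasure μ] {a b : ℝ}
    (hab : a ≤ b) :
    (((∫ u, fejerKernel u) * (fejerMeasure ∗ μ).real (Set.Ioc a b) : ℝ) : ℂ)
      = ∫ t in (-1 : ℝ)..1, ((1 - |t| : ℝ) : ℂ) * charFun μ t
        * ∫ s in a..b, Complex.exp (-(t * s * Complex.I)) := by
  have : Continuous fun t : ℝ => ∫ s in a..b, Complex.exp (-(t * s * Complex.I)) :=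
    intervalIntegral.continuous_parametric_intervalIntegral_of_continuous' (by fun_prop) a b
  have hkernel : (∫ u, fejerKernel u) * (fejerMeasure ∗ μ).real (Set.Ioc a b)
      = ∫ y, (∫ s in a..b, fejerKernel (s - y)) ∂μ := by
    rw [Measure.conv_comm, measureReal_conv_eq_integral _ _ measurableSet_Ioc]
    simp only [Set.preimage_const_add_Ioc, measureReal_fejerMeasure_Ioc_sub hab]
    rw [integral_div, mul_div_cancel₀ _ integral_fejerKernel_pos.ne']
  have hint : Integrable (Function.uncurry fun (y t : ℝ) =>
      ((1 - |t| : ℝ) : ℂ) * Complex.exp (t * y * Complex.I)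
        * ∫ s in a..b, Complex.exp (-(t * s * Complex.I)))
      (μ.prod (volume.restrict (Set.Ioc (-1) 1))) := by
    have hweight : Integrable (fun t : ℝ => ((1 - |t| : ℝ) : ℂ)
        * ∫ s in a..b, Complex.exp (-(t * s * Complex.I))) (volume.restrict (Set.Ioc (-1) 1)) :=
      (by fun_prop : Continuous _).integrableOn_Ioc
    refine ((hweight.comp_snd μ).bdd_mul (c := 1)
      (f := fun p : ℝ × ℝ => Complex.exp (p.2 * p.1 * Complex.I))
      (by fun_prop : Continuous _).aestronglyMeasurable (.of_forall fun p => ?_)).congr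
      (.of_forall fun p => ?_)
    · rw [Complex.norm_exp]
      simp
    · simp only [Function.uncurry]
      ring
  rw [hkernel, ← integral_complex_ofReal]
  simp_rw [integral_fejerKernel_sub_eq,
    intervalIntegral.integral_of_le (neg_le_self (zero_le_one' ℝ))]
  rw [integral_integral_swap hint]
  congr! 2
  rw [integral_mul_const, integral_const_mul, charFun_apply_real]

end Fejer

section Esseen

variable {μ ν : Measure ℝ} [IsProbabilityMeasure μ] [IsProbabilityMeasure ν]

theorem abs_measureReal_fejerMeasure_conv_Ioc_sub_le {w : ℝ → ℝ}
    (hw : IntervalIntegrable w volume (-1) 1)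
    (h : ∀ t, |t| ≤ 1 → ‖charFun μ t - charFun ν t‖ ≤ |t| * w t) {a b : ℝ} (hab : a ≤ b) :
    |(fejerMeasure ∗ μ).real (Set.Ioc a b) - (fejerMeasure ∗ ν).real (Set.Ioc a b)|
      ≤ 2 / (∫ u, fejerKernel u) * ∫ t in (-1 : ℝ)..1, w t := by
  have : Continuous (charFun μ) := continuous_charFun
  have : Continuous (charFun ν) := continuous_charFun
  have : Continuous fun t : ℝ => ∫ s in a..b, Complex.exp (-(t * s * Complex.I)) :=
    intervalIntegral.continuous_parametric_intervalIntegral_of_continuous' (by fun_prop) a b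
  have hdiff : (((∫ u, fejerKernel u) * ((fejerMeasure ∗ μ).real (Set.Ioc a b)
        - (fejerMeasure ∗ ν).real (Set.Ioc a b)) : ℝ) : ℂ)
      = ∫ t in (-1 : ℝ)..1, ((1 - |t| : ℝ) : ℂ) * (charFun μ t - charFun ν t)
        * ∫ s in a..b, Complex.exp (-(t * s * Complex.I)) := by
    rw [mul_sub, Complex.ofReal_sub, measureReal_fejerMeasure_conv_Ioc μ hab,
      measureReal_fejerMeasure_conv_Ioc ν hab, ← intervalIntegral.integral_sub
        ((by fun_prop : Continuous _).intervalIntegrable _ _)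
        ((by fun_prop : Continuous _).intervalIntegrable _ _)]
    congr! 2 with t
    ring
  have hbound : ‖∫ t in (-1 : ℝ)..1, ((1 - |t| : ℝ) : ℂ) * (charFun μ t - charFun ν t)
        * ∫ s in a..b, Complex.exp (-(t * s * Complex.I))‖ ≤ ∫ t in (-1 : ℝ)..1, 2 * w t := by
    refine intervalIntegral.norm_integral_le_of_norm_le (by norm_num) ?_ (hw.const_mul 2)
    filter_upwards [Measure.ae_ne volume (0 : ℝ)] with t ht0 ht
    have ht1 : |t| ≤ 1 := abs_le.2 ⟨ht.1.le, ht.2⟩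
    have hnorm : ‖((1 - |t| : ℝ) : ℂ)‖ ≤ 1 := by
      rw [Complex.norm_real, Real.norm_of_nonneg (sub_nonneg.2 ht1)]
      linarith [abs_nonneg t]
    have := abs_pos.2 ht0
    rw [norm_mul, norm_mul]
    calc ‖((1 - |t| : ℝ) : ℂ)‖ * ‖charFun μ t - charFun ν t‖
          * ‖∫ s in a..b, Complex.exp (-(t * s * Complex.I))‖
        ≤ 1 * (|t| * w t) * (2 / |t|) := by
          gcongr
          · exact mul_nonneg zero_le_one ((norm_nonneg _).trans (h t ht1))
          · exact h t ht1
          · exact norm_integral_exp_neg_mul_I_le a b ht0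
      _ = 2 * w t := by field_simp
  have hpos := integral_fejerKernel_pos
  rw [← hdiff, Complex.norm_real, norm_mul, Real.norm_of_nonneg hpos.le, Real.norm_eq_abs,
    intervalIntegral.integral_const_mul] at hbound
  rw [div_mul_eq_mul_div, le_div_iff₀ hpos]
  linarith

theorem exists_abs_cdf_sub_cdf_le_of_charFun_unit : ∃ C : ℝ, 0 ≤ C ∧
    ∀ (μ ν : Measure ℝ) [IsProbabilityMeasure μ] [IsProbabilityMeasure ν] (m : NNReal)
      (w : ℝ → ℝ), LipschitzWith m (cdf ν) → IntervalIntegrable w volume (-1) 1 →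
      (∀ t, |t| ≤ 1 → ‖charFun μ t - charFun ν t‖ ≤ |t| * w t) →
      ∀ x, |cdf μ x - cdf ν x| ≤ C * ((∫ t in (-1 : ℝ)..1, w t) + m) := by
  obtain ⟨η, hη⟩ := exists_le_measureReal_Icc_neg fejerMeasure (r := 3 / 4) (by norm_num)
  have hpos := integral_fejerKernel_pos
  refine ⟨max (3 * η) (4 / ∫ u, fejerKernel u), le_max_of_le_right (by positivity), ?_⟩
  intro μ ν _ _ m w hν hw h x
  have hsmooth := abs_cdf_sub_cdf_le_of_Ioc (μ := fejerMeasure ∗ μ) (ν := fejerMeasure ∗ ν)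
    fun a b hab => abs_measureReal_fejerMeasure_conv_Ioc_sub_le hw h hab
  have hw_nonneg : 0 ≤ ∫ t in (-1 : ℝ)..1, w t :=
    nonneg_of_mul_nonneg_right ((abs_nonneg _).trans (hsmooth 0)) (by positivity)
  calc |cdf μ x - cdf ν x|
      ≤ 3 * m * η + 2 * (2 / (∫ u, fejerKernel u) * ∫ t in (-1 : ℝ)..1, w t) :=
        abs_cdf_sub_cdf_le_of_conv hη hν hsmooth x
    _ = 3 * η * m + 4 / (∫ u, fejerKernel u) * ∫ t in (-1 : ℝ)..1, w t := by ring
    _ ≤ _ := by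
        rw [mul_add, add_comm]
        gcongr
        exacts [le_max_right _ _, le_max_left _ _]

theorem cdf_map_const_mul {U : ℝ} (hU : 0 < U) (μ : Measure ℝ) [IsProbabilityMeasure μ] (x : ℝ) :
    cdf (μ.map (U * ·)) x = cdf μ (x / U) := by
  have hmeas : Measurable (U * · : ℝ → ℝ) := measurable_const_mul U
  have := Measure.isProbabilityMeasure_map (μ := μ) hmeas.aemeasurable
  rw [cdf_eq_real, cdf_eq_real, map_measureReal_apply hmeas measurableSet_Iic,
    Set.preimage_const_mul_Iic₀ x hU]

theorem exists_abs_cdf_sub_cdf_le_of_charFun : ∃ C : ℝ, 0 ≤ C ∧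
    ∀ (μ ν : Measure ℝ) [IsProbabilityMeasure μ] [IsProbabilityMeasure ν] (m : NNReal) (U : ℝ)
      (w : ℝ → ℝ), LipschitzWith m (cdf ν) → 0 < U → IntervalIntegrable w volume (-U) U →
      (∀ t, |t| ≤ U → ‖charFun μ t - charFun ν t‖ ≤ |t| * w t) →
      ∀ x, |cdf μ x - cdf ν x| ≤ C * ((∫ t in (-U)..U, w t) + m / U) := by
  obtain ⟨C, hC, hunit⟩ := exists_abs_cdf_sub_cdf_le_of_charFun_unit
  refine ⟨C, hC, fun μ ν _ _ m U w hν hU hw h x => ?_⟩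
  have hmeas : AEMeasurable (U * · : ℝ → ℝ) μ := by fun_prop
  have hmeas' : AEMeasurable (U * · : ℝ → ℝ) ν := by fun_prop
  have := Measure.isProbabilityMeasure_map hmeas
  have := Measure.isProbabilityMeasure_map hmeas'
  have hlip : LipschitzWith (m / U.toNNReal) (cdf (ν.map (U * ·))) := by
    refine .of_dist_le_mul fun a b => ?_
    rw [cdf_map_const_mul hU, cdf_map_const_mul hU]
    refine (hν.dist_le_mul _ _).trans_eq ?_
    rw [Real.dist_eq, Real.dist_eq, ← sub_div, abs_div, abs_of_pos hU, NNReal.coe_div,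
      Real.coe_toNNReal _ hU.le]
    ring
  have hscaled := hunit (μ.map (U * ·)) (ν.map (U * ·)) _ (fun t => U * w (U * t)) hlip ?_ ?_
    (U * x)
  · rwa [cdf_map_const_mul hU, cdf_map_const_mul hU, mul_div_cancel_left₀ x hU.ne',
      intervalIntegral.integral_const_mul, intervalIntegral.mul_integral_comp_mul_left, mul_neg,
      mul_one, NNReal.coe_div, Real.coe_toNNReal _ hU.le] at hscaled
  · simpa [hU.ne', neg_div] using (hw.comp_mul_left (c := U)).const_mul U
  · intro t ht
    rw [charFun_map_mul, charFun_map_mul]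
    refine (h (U * t) ?_).trans_eq ?_
    · rw [abs_mul, abs_of_pos hU]
      exact mul_le_of_le_one_right hU.le ht
    · rw [abs_mul, abs_of_pos hU]
      ring

end Esseen

section LaplaceIntegral

theorem abs_integral_sub_integral_le_of_superlevel {α : Type*} [MeasurableSpace α]
    {μ ν : Measure α} [IsProbabilityMeasure μ] [IsProbabilityMeasure ν] {f : α → ℝ} {ε : ℝ}
    (hf : Measurable f) (hf0 : ∀ a, 0 ≤ f a) (hf1 : ∀ a, f a ≤ 1)
    (h : ∀ t ∈ Set.Ioc (0 : ℝ) 1, |μ.real {a | t ≤ f a} - ν.real {a | t ≤ f a}| ≤ ε) :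
    |∫ a, f a ∂μ - ∫ a, f a ∂ν| ≤ ε := by
  have hlayer (ρ : Measure α) [IsProbabilityMeasure ρ] :
      ∫ a, f a ∂ρ = ∫ t in Set.Ioc (0 : ℝ) 1, ρ.real {a | t ≤ f a} := by
    refine Integrable.integral_eq_integral_Ioc_meas_le (.of_bound hf.aestronglyMeasurable 1
      (.of_forall fun a => ?_)) (.of_forall hf0) (.of_forall hf1)
    rw [Real.norm_of_nonneg (hf0 a)]
    exact hf1 a
  have hint (ρ : Measure α) [IsProbabilityMeasure ρ] :
      IntegrableOn (fun t => ρ.real {a | t ≤ f a}) (Set.Ioc (0 : ℝ) 1) := by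
    have hanti : Antitone fun t => ρ.real {a | t ≤ f a} :=
      fun s t hst => measureReal_mono fun a ha => hst.trans ha
    refine Integrable.of_bound hanti.measurable.aestronglyMeasurable 1 (.of_forall fun t => ?_)
    rw [Real.norm_of_nonneg measureReal_nonneg]
    exact measureReal_le_one
  rw [hlayer μ, hlayer ν, ← integral_sub (hint μ) (hint ν)]
  simp_rw [← Real.norm_eq_abs] at h
  simpa using norm_setIntegral_le_of_norm_le_const (μ := volume) measure_Ioc_lt_top h

variable {μ ν : Measure ℝ} [IsProbabilityMeasure μ] [IsProbabilityMeasure ν] {Δ : ℝ}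

theorem tendsto_cdf_measureReal_Iio (μ : Measure ℝ) [IsProbabilityMeasure μ] (x : ℝ) :
    Tendsto (cdf μ) (𝓝[<] x) (𝓝 (μ.real (Set.Iio x))) := by
  rw [← measure_cdf μ, measureReal_def, StieltjesFunction.measure_Iio _ (tendsto_cdf_atBot μ),
    sub_zero, measure_cdf,
    ENNReal.toReal_ofReal ((cdf_nonneg μ _).trans ((monotone_cdf μ).le_leftLim (sub_one_lt x)))]
  exact (monotone_cdf μ).tendsto_leftLim x

theorem abs_measureReal_Iio_sub_le (h : ∀ x, |cdf μ x - cdf ν x| ≤ Δ) (x : ℝ) :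
    |μ.real (Set.Iio x) - ν.real (Set.Iio x)| ≤ Δ :=
  le_of_tendsto ((tendsto_cdf_measureReal_Iio μ x).sub (tendsto_cdf_measureReal_Iio ν x)).abs
    (.of_forall h)

theorem abs_measureReal_Icc_sub_le (h : ∀ x, |cdf μ x - cdf ν x| ≤ Δ) {a b : ℝ} (hab : a ≤ b) :
    |μ.real (Set.Icc a b) - ν.real (Set.Icc a b)| ≤ 2 * Δ := by
  have hIcc (ρ : Measure ℝ) [IsProbabilityMeasure ρ] :
      ρ.real (Set.Icc a b) = cdf ρ b - ρ.real (Set.Iio a) := by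
    rw [cdf_eq_real, ← Set.Iic_sdiff_Iio,
      measureReal_sdiff (Set.Iio_subset_Iic hab) measurableSet_Iio]
  rw [hIcc, hIcc, sub_sub_sub_comm]
  linarith [abs_sub (cdf μ b - cdf ν b) (μ.real (Set.Iio a) - ν.real (Set.Iio a)), h b,
    abs_measureReal_Iio_sub_le h a]

theorem abs_measureReal_Ici_sub_le (h : ∀ x, |cdf μ x - cdf ν x| ≤ Δ) (a : ℝ) :
    |μ.real (Set.Ici a) - ν.real (Set.Ici a)| ≤ Δ := by
  rw [← Set.compl_Iio, probReal_compl_eq_one_sub measurableSet_Iio,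
    probReal_compl_eq_one_sub measurableSet_Iio, sub_sub_sub_cancel_left, abs_sub_comm]
  exact abs_measureReal_Iio_sub_le h a

theorem abs_setIntegral_exp_neg_mul_sub_le (h : ∀ x, |cdf μ x - cdf ν x| ≤ Δ) {x : ℝ}
    (hx : 0 ≤ x) :
    |(∫ v in Set.Ici 0, Real.exp (-(x * v)) ∂μ) - ∫ v in Set.Ici 0, Real.exp (-(x * v)) ∂ν|
      ≤ 2 * Δ := by
  have hΔ : 0 ≤ Δ := (abs_nonneg _).trans (h 0)
  rw [← integral_indicator measurableSet_Ici, ← integral_indicator measurableSet_Ici]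
  refine abs_integral_sub_integral_le_of_superlevel
    ((by fun_prop : Measurable fun v => Real.exp (-(x * v))).indicator measurableSet_Ici)
    (Set.indicator_nonneg fun v _ => (Real.exp_pos _).le)
    (fun v => Set.indicator_apply_le' (fun hv => Real.exp_le_one_iff.2
      (neg_nonpos.2 (mul_nonneg hx hv))) fun _ => zero_le_one) fun t ht => ?_
  have hmem (v : ℝ) : t ≤ (Set.Ici 0).indicator (fun v => Real.exp (-(x * v))) v
      ↔ 0 ≤ v ∧ x * v ≤ -Real.log t := by
    rcases le_or_gt 0 v with hv | hv
    · rw [Set.indicator_of_mem (Set.mem_Ici.2 hv), ← Real.log_le_iff_le_exp ht.1, le_neg]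
      simp [hv]
    · rw [Set.indicator_of_notMem (Set.notMem_Ici.2 hv)]
      simp [hv.not_ge, ht.1]
  have hlog : 0 ≤ -Real.log t := neg_nonneg.2 (Real.log_nonpos ht.1.le ht.2)
  simp_rw [hmem]
  rcases hx.eq_or_lt with rfl | hx
  · have hset : {v : ℝ | 0 ≤ v ∧ 0 * v ≤ -Real.log t} = Set.Ici 0 := by
      ext v
      simp only [zero_mul, hlog, and_true, Set.mem_ofPred_eq, Set.mem_Ici]
    rw [hset]
    linarith [abs_measureReal_Ici_sub_le h 0]
  · have hset : {v | 0 ≤ v ∧ x * v ≤ -Real.log t} = Set.Icc 0 (-Real.log t / x) := by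
      ext v
      simp only [Set.mem_ofPred_eq, Set.mem_Icc, le_div_iff₀' hx]
    rw [hset]
    exact abs_measureReal_Icc_sub_le h (div_nonneg hlog hx.le)

end LaplaceIntegral

section Tilting

variable {Ω : Type*} [MeasurableSpace Ω] {P : Measure Ω} {Y : Ω → ℝ} {x : ℝ}

/-- The law of `Y - x` under the measure `P` tilted by `exp (x * Y)` (Cramér's conjugate law,
centred at `x`). -/
noncomputable def tiltedLaw (P : Measure Ω) (Y : Ω → ℝ) (x : ℝ) : Measure ℝ :=
  (P.tilted fun ω => x * Y ω).map fun ω => Y ω - x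

theorem isProbabilityMeasure_tiltedLaw [NeZero P] (hY : AEMeasurable Y P)
    (hx : Integrable (fun ω => Real.exp (x * Y ω)) P) :
    IsProbabilityMeasure (tiltedLaw P Y x) :=
  have := isProbabilityMeasure_tilted hx
  Measure.isProbabilityMeasure_map
    ((hY.mono_ac (tilted_absolutelyContinuous _ _)).sub_const x)

theorem charFun_tiltedLaw (hY : AEMeasurable Y P) (t : ℝ) :
    charFun (tiltedLaw P Y x) t
      = Complex.exp (-(t * x * Complex.I)) * complexMGF Y P (x + t * Complex.I) / mgf Y P x := by
  rw [charFun_apply_real, tiltedLaw, integral_map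
    ((hY.mono_ac (tilted_absolutelyContinuous _ _)).sub_const x)
    (by fun_prop : Continuous _).aestronglyMeasurable, integral_tilted_mul_eq_mgf, complexMGF,
    ← integral_const_mul, ← integral_div]
  congr! 2
  rw [Complex.real_smul]
  push_cast
  rw [div_mul_eq_mul_div, ← Complex.exp_add, ← Complex.exp_add]
  ring_nf

theorem measureReal_le_eq_mgf_mul_setIntegral_tiltedLaw [IsProbabilityMeasure P]
    (hY : AEMeasurable Y P) (hx : Integrable (fun ω => Real.exp (x * Y ω)) P) :
    P.real {ω | x ≤ Y ω} = mgf Y P x * Real.exp (-x ^ 2)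
      * ∫ v in Set.Ici 0, Real.exp (-(x * v)) ∂(tiltedLaw P Y x) := by
  have hM : 0 < mgf Y P x := mgf_pos hx
  have hpre : (fun ω => Y ω - x) ⁻¹' Set.Ici 0 = {ω | x ≤ Y ω} := by
    ext ω
    simp
  have hone (ω : Ω) : mgf Y P x * Real.exp (-x ^ 2)
      * ((Real.exp (x * Y ω) / mgf Y P x) • Real.exp (-(x * (Y ω - x)))) = 1 := by
    have hexp : Real.exp (-x ^ 2) * Real.exp (x * Y ω) * Real.exp (-(x * (Y ω - x))) = 1 := by
      rw [← Real.exp_add, ← Real.exp_add, Real.exp_eq_one_iff]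
      ring
    rw [smul_eq_mul]
    field_simp
    linarith
  rw [tiltedLaw, setIntegral_map measurableSet_Ici
    (by fun_prop : Continuous _).aestronglyMeasurable
    ((hY.mono_ac (tilted_absolutelyContinuous _ _)).sub_const x), hpre,
    setIntegral_tilted_mul_eq_mgf, ← integral_const_mul]
  simp_rw [hone]
  simp

end Tilting

section StandardGaussian

theorem gaussianReal_zero_one_le_volume : gaussianReal 0 1 ≤ volume := by
  have hpdf (x : ℝ) : gaussianPDF 0 1 x ≤ 1 := by
    rw [gaussianPDF, ENNReal.ofReal_le_one, gaussianPDFReal]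
    refine mul_le_one₀ (inv_le_one_of_one_le₀ (Real.one_le_sqrt.2 ?_)) (Real.exp_pos _).le ?_
    · rw [NNReal.coe_one]
      linarith [Real.pi_gt_three]
    · rw [Real.exp_le_one_iff, NNReal.coe_one]
      linarith [sq_nonneg (x - 0)]
  rw [gaussianReal_of_var_ne_zero 0 one_ne_zero]
  exact (withDensity_mono (.of_forall hpdf)).trans_eq withDensity_one

theorem lipschitzWith_one_cdf_of_le_volume {μ : Measure ℝ} [IsProbabilityMeasure μ]
    (hμ : μ ≤ volume) : LipschitzWith 1 (cdf μ) := by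
  refine .of_le_add fun y x => ?_
  rcases le_total x y with hxy | hxy
  · rw [← sub_le_iff_le_add', ← measureReal_Ioc_eq_cdf_sub μ hxy, Real.dist_eq,
      abs_of_nonneg (sub_nonneg.2 hxy), ← Real.volume_real_Ioc_of_le hxy]
    exact ENNReal.toReal_mono measure_Ioc_lt_top.ne (hμ _)
  · exact (monotone_cdf μ hxy).trans (le_add_of_nonneg_right dist_nonneg)

theorem mul_setIntegral_exp_neg_mul_le_one_of_le_volume {μ : Measure ℝ} (hμ : μ ≤ volume) {x : ℝ}
    (hx : 0 ≤ x) : x * ∫ v in Set.Ici 0, Real.exp (-(x * v)) ∂μ ≤ 1 := by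
  rcases hx.eq_or_lt with rfl | hx
  · simp
  · have hvol : ∫ v in Set.Ici 0, Real.exp (-x * v) = x⁻¹ := by
      rw [integral_Ici_eq_integral_Ioi, integral_exp_mul_Ioi (neg_neg_of_pos hx), mul_zero,
        Real.exp_zero, neg_div_neg_eq, one_div]
    have hle : ∫ v in Set.Ici 0, Real.exp (-x * v) ∂μ ≤ x⁻¹ := hvol ▸
      integral_mono_measure (Measure.restrict_mono le_rfl hμ)
        (.of_forall fun v => (Real.exp_pos _).le)
        ((integrableOn_Ici_iff_integrableOn_Ioi (b := 0)).2
          (integrableOn_exp_mul_Ioi (neg_neg_of_pos hx) 0))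
    simp_rw [← neg_mul]
    exact (mul_le_mul_of_nonneg_left hle hx.le).trans_eq (mul_inv_cancel₀ hx.ne')

theorem tiltedLaw_id_gaussianReal (x : ℝ) :
    tiltedLaw (gaussianReal 0 1) id x = gaussianReal 0 1 := by
  have := isProbabilityMeasure_tiltedLaw aemeasurable_id
    (integrable_exp_mul_gaussianReal (μ := 0) (v := 1) x)
  refine Measure.ext_of_charFun (funext fun t => ?_)
  rw [charFun_tiltedLaw aemeasurable_id, complexMGF_id_gaussianReal, charFun_gaussianReal,
    mgf_id_gaussianReal, Complex.ofReal_exp, ← Complex.exp_add, ← Complex.exp_sub]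
  congr 1
  push_cast
  linear_combination (t ^ 2 / 2 : ℂ) * Complex.I_sq

theorem measureReal_gaussianReal_Ici (x : ℝ) : (gaussianReal 0 1).real (Set.Ici x)
    = Real.exp (-x ^ 2 / 2) * ∫ v in Set.Ici 0, Real.exp (-(x * v)) ∂(gaussianReal 0 1) := by
  have h := measureReal_le_eq_mgf_mul_setIntegral_tiltedLaw (Y := id) aemeasurable_id
    (integrable_exp_mul_gaussianReal (μ := 0) (v := 1) x)
  rw [tiltedLaw_id_gaussianReal, mgf_id_gaussianReal, ← Real.exp_add] at h
  convert! h using 3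
  rw [NNReal.coe_one]
  ring

end StandardGaussian

section Schwarz

variable {E : Type*} [NormedAddCommGroup E] [NormedSpace ℂ E] {f : ℂ → E} {c z h : ℂ} {R B : ℝ}
  {n : ℕ}

theorem norm_le_mul_pow_of_iteratedDeriv_eq_zero [CompleteSpace E]
    (hf : DifferentiableOn ℂ f (Metric.ball c R)) (hB : ∀ z ∈ Metric.ball c R, ‖f z‖ ≤ B)
    (hn : ∀ k < n, iteratedDeriv k f c = 0) (hz : z ∈ Metric.ball c R) :
    ‖f z‖ ≤ B * (‖z - c‖ / R) ^ n := by
  rcases n with - | n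
  · simpa using hB z hz
  have hc : c ∈ Metric.ball c R := Metric.mem_ball_self (Metric.pos_of_mem_ball hz)
  have hfc : f c = 0 := by simpa using hn 0 n.succ_pos
  have han : AnalyticAt ℂ f c := hf.analyticAt (Metric.isOpen_ball.mem_nhds hc)
  obtain ⟨g, hg, hfg⟩ := (natCast_le_analyticOrderAt han).1
    ((natCast_le_analyticOrderAt_iff_iteratedDeriv_eq_zero han).2 hn)
  have hbig : f =O[𝓝 c] fun w => (w - c) ^ (n + 1) := by
    have hsmul := (Asymptotics.isBigO_refl (fun w => (w - c) ^ (n + 1)) (𝓝 c)).smul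
      (hg.continuousAt.norm.isBoundedUnder_le.isBigO_one ℂ)
    simpa using hsmul.congr' (hfg.mono fun _ => Eq.symm) .rfl
  have hlittle : (fun w => f w - f c) =o[𝓝 c] fun w => ‖w - c‖ ^ n := by
    have hpow := (Asymptotics.isLittleO_pow_pow (𝕜 := ℂ) n.lt_succ_self).comp_tendsto
      (tendsto_sub_nhds_zero_iff.2 (tendsto_id (x := 𝓝 c)))
    simpa [hfc, Function.comp_def] using (hbig.trans_isLittleO hpow).norm_right
  simpa [hfc, dist_eq_norm] using
    Complex.dist_le_mul_div_pow_of_mapsTo_ball_of_isLittleO hf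
      (fun w hw => by simpa [hfc] using hB w hw) hlittle hz

theorem norm_deriv_le_mul_pow_of_iteratedDeriv_eq_zero [CompleteSpace E]
    (hf : DifferentiableOn ℂ f (Metric.ball c R)) (hB : ∀ z ∈ Metric.ball c R, ‖f z‖ ≤ B)
    (hn : ∀ k < n, iteratedDeriv (k + 1) f c = 0) (hz : z ∈ Metric.ball c (R / 2)) :
    ‖deriv f z‖ ≤ B / (R / 2) * (‖z - c‖ / (R / 2)) ^ n := by
  have hR : 0 < R / 2 := Metric.pos_of_mem_ball hz
  refine norm_le_mul_pow_of_iteratedDeriv_eq_zero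
    ((hf.deriv Metric.isOpen_ball).mono (Metric.ball_subset_ball (by linarith))) (fun w hw => ?_)
    (fun k hk => by rw [← iteratedDeriv_succ', hn k hk]) hz
  have hsub : Metric.closedBall w (R / 2) ⊆ Metric.ball c R :=
    Metric.closedBall_subset_ball' (by linarith [Metric.mem_ball.1 hw])
  exact Complex.norm_deriv_le_of_forall_mem_sphere_norm_le hR
    ((hf.mono hsub).diffContOnCl_ball subset_rfl)
    fun y hy => hB y (hsub (Metric.sphere_subset_closedBall hy))

theorem norm_add_sub_le_of_norm_deriv_le_pow (hf : DifferentiableOn ℂ f (Metric.ball 0 R))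
    (hB : 0 ≤ B) (hd : ∀ z ∈ Metric.ball 0 R, ‖deriv f z‖ ≤ B * ‖z‖ ^ n) (hzh : ‖z‖ + ‖h‖ < R) :
    ‖f (z + h) - f z‖ ≤ B * (‖z‖ + ‖h‖) ^ n * ‖h‖ := by
  have hsub : Metric.closedBall (0 : ℂ) (‖z‖ + ‖h‖) ⊆ Metric.ball 0 R :=
    Metric.closedBall_subset_ball hzh
  have hbound : ∀ w ∈ Metric.closedBall (0 : ℂ) (‖z‖ + ‖h‖),
      ‖deriv f w‖ ≤ B * (‖z‖ + ‖h‖) ^ n := fun w hw =>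
    (hd w (hsub hw)).trans (by gcongr; simpa using hw)
  simpa using (convex_closedBall 0 _).norm_image_sub_le_of_norm_deriv_le
    (fun w hw => hf.differentiableAt (Metric.isOpen_ball.mem_nhds (hsub hw))) hbound
    (x := z) (y := z + h) (by simp) (by simpa using norm_add_le z h)

end Schwarz

section IteratedDeriv

theorem hasSum_iteratedDeriv_tsum {ι E : Type*} [NormedAddCommGroup E] [NormedSpace ℂ E]
    [CompleteSpace E] {f : ι → ℂ → E} {u : ι → ℝ} {c : ℂ} {R : ℝ} (hR : 0 < R) (hu : Summable u)
    (hf : ∀ i, DifferentiableOn ℂ (f i) (Metric.ball c R))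
    (hfu : ∀ i, ∀ z ∈ Metric.ball c R, ‖f i z‖ ≤ u i) (k : ℕ) :
    HasSum (fun i => iteratedDeriv k (f i) c) (iteratedDeriv k (fun z => ∑' i, f i z) c) := by
  induction k generalizing f u R with
  | zero =>
    simpa using (Summable.of_norm_bounded hu fun i =>
      hfu i c (Metric.mem_ball_self hR)).hasSum
  | succ k ih =>
    have hderiv := ih (half_pos hR) (hu.div_const (R / 2))
      (fun i => ((hf i).deriv Metric.isOpen_ball).mono (Metric.ball_subset_ball (by linarith)))
      fun i z hz => by
        simpa using norm_deriv_le_mul_pow_of_iteratedDeriv_eq_zero (n := 0) (hf i) (hfu i)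
          (by simp) hz
    have heq : (fun z => ∑' i, deriv (f i) z) =ᶠ[𝓝 c] deriv fun z => ∑' i, f i z := by
      filter_upwards [Metric.ball_mem_nhds c hR] with z hz
      exact (Complex.hasSum_deriv_of_summable_norm hu hf Metric.isOpen_ball hfu hz).tsum_eq
    simpa only [iteratedDeriv_succ', heq.iteratedDeriv_eq] using hderiv

theorem iteratedDeriv_comp_mul_left {𝕜 F : Type*} [NontriviallyNormedField 𝕜]
    [NormedAddCommGroup F] [NormedSpace 𝕜 F] (c : 𝕜) (k : ℕ) (f : 𝕜 → F) :
    iteratedDeriv k (fun z => f (c * z)) = fun z => c ^ k • iteratedDeriv k f (c * z) := by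
  induction k with
  | zero => simp
  | succ k ih =>
    ext z
    rw [iteratedDeriv_succ, ih, deriv_fun_const_smul_field, deriv_comp_mul_left, smul_smul,
      iteratedDeriv_succ, pow_succ]

theorem deriv_eq_ofReal_deriv {F : ℂ → ℂ} {f : ℝ → ℝ} {a : ℝ} (hF : DifferentiableAt ℂ F a)
    (h : ∀ᶠ t : ℝ in 𝓝 a, F t = f t) : deriv F a = deriv f a := by
  have hre : HasDerivAt f (deriv F a).re a := hF.hasDerivAt.real_of_complex.congr_of_eventuallyEq
    (h.mono fun t ht => by simp [ht])
  rw [hre.deriv]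
  exact hF.hasDerivAt.comp_ofReal.unique (hre.ofReal_comp.congr_of_eventuallyEq h)

theorem iteratedDeriv_eq_ofReal_iteratedDeriv {F : ℂ → ℂ} {f : ℝ → ℝ} {a : ℝ}
    (hF : AnalyticAt ℂ F a) (h : ∀ᶠ t : ℝ in 𝓝 a, F t = f t) (k : ℕ) :
    iteratedDeriv k F a = iteratedDeriv k f a := by
  induction k generalizing F f with
  | zero => simpa using h.self_of_nhds
  | succ k ih =>
    rw [iteratedDeriv_succ', iteratedDeriv_succ']
    refine ih hF.deriv ?_
    filter_upwards [(Complex.continuous_ofReal.tendsto a).eventually hF.eventually_analyticAt,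
      h.eventually_nhds] with t hFt hft
    exact deriv_eq_ofReal_deriv hFt.differentiableAt hft

end IteratedDeriv

section ComplexCGF

variable {Ω : Type*} [MeasurableSpace Ω] {P : Measure Ω} {Y : Ω → ℝ} {r : ℝ} {L : ℂ → ℂ}

theorem IsComplexCGF.integrable_exp_mul (hL : IsComplexCGF P Y r L) {t : ℝ} (ht : |t| < r) :
    Integrable (fun ω => Real.exp (t * Y ω)) P := by
  simpa [Complex.norm_exp] using (hL.integrable_exp t (by simpa using ht)).norm

theorem IsComplexCGF.aemeasurable (hL : IsComplexCGF P Y r L) (hr : 0 < r) : AEMeasurable Y P :=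
  Real.aemeasurable_of_aemeasurable_exp_mul (half_pos hr).ne'
    (hL.integrable_exp_mul (by rw [abs_of_pos] <;> linarith)).aemeasurable

theorem mem_interior_integrableExpSet_of_abs_lt
    (h : ∀ t, |t| < r → Integrable (fun ω => Real.exp (t * Y ω)) P) {t : ℝ} (ht : |t| < r) :
    t ∈ interior (integrableExpSet Y P) :=
  interior_maximal (fun s hs => h s hs) (isOpen_lt continuous_abs continuous_const) ht

theorem IsComplexCGF.zero_mem_interior_integrableExpSet (hL : IsComplexCGF P Y r L) (hr : 0 < r) :
    0 ∈ interior (integrableExpSet Y P) :=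
  mem_interior_integrableExpSet_of_abs_lt (fun _ => hL.integrable_exp_mul) (by simpa)

theorem IsComplexCGF.mgf_eq (hL : IsComplexCGF P Y r L) {t : ℝ} (ht : |t| < r) :
    mgf Y P t = Real.exp (L t).re := by
  rw [← Complex.norm_exp, hL.exp_eq t (by simpa using ht), complexMGF_ofReal, Complex.norm_real,
    Real.norm_of_nonneg mgf_nonneg]

theorem IsComplexCGF.eventually_eq_cgf (hL : IsComplexCGF P Y r L) (hr : 0 < r) :
    ∀ᶠ t : ℝ in 𝓝 0, L t = cgf Y P t := by
  have hL0 : Tendsto L (𝓝 0) (𝓝 0) := by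
    simpa [hL.map_zero] using (hL.analytic 0 (Metric.mem_ball_self hr)).continuousAt.tendsto
  have hreal : Tendsto ((↑) : ℝ → ℂ) (𝓝 0) (𝓝 0) := Complex.continuous_ofReal.tendsto' 0 0 rfl
  filter_upwards [(hL0.comp hreal).eventually (Metric.ball_mem_nhds 0 one_pos),
    hreal.eventually (Metric.ball_mem_nhds 0 hr)] with t hLt ht
  have him := abs_lt.1 ((Complex.abs_im_le_norm (L t)).trans_lt (by simpa using hLt))
  rw [← Complex.log_exp (x := L t) (by linarith [Real.pi_gt_three])
    (by linarith [Real.pi_gt_three]), hL.exp_eq t ht, complexMGF_ofReal, cgf,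
    Complex.ofReal_log mgf_nonneg]

theorem IsComplexCGF.iteratedDeriv_zero_eq_cumulant (hL : IsComplexCGF P Y r L) (hr : 0 < r)
    (k : ℕ) : iteratedDeriv k L 0 = cumulant P Y k := by
  simpa [cumulant] using iteratedDeriv_eq_ofReal_iteratedDeriv (a := 0)
    (by simpa using hL.analytic 0 (Metric.mem_ball_self hr)) (hL.eventually_eq_cgf hr) k

theorem IsComplexCGF.cumulant_one [IsProbabilityMeasure P] (hL : IsComplexCGF P Y r L)
    (hr : 0 < r) : cumulant P Y 1 = ∫ ω, Y ω ∂P := by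
  simp [cumulant, deriv_cgf_zero (hL.zero_mem_interior_integrableExpSet hr)]

theorem IsComplexCGF.cumulant_two [IsProbabilityMeasure P] (hL : IsComplexCGF P Y r L)
    (hr : 0 < r) : cumulant P Y 2 = Var[Y; P] := by
  have h0 := hL.zero_mem_interior_integrableExpSet hr
  simp [cumulant, iteratedDeriv_two_cgf_eq_integral h0, deriv_cgf_zero h0,
    variance_eq_integral (hL.aemeasurable hr)]

end ComplexCGF

section ComplexCGFSum

variable {Ω ι κ : Type*} [MeasurableSpace Ω] {P : Measure Ω} {Y : Ω → ℝ} {r : ℝ} {L : ℂ → ℂ}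

theorem isComplexCGF_of_exp_eq (hL : AnalyticOnNhd ℂ L (Metric.ball 0 r)) (hL0 : L 0 = 0)
    (h : ∀ z ∈ Metric.ball (0 : ℂ) r, Complex.exp (L z) = complexMGF Y P z) :
    IsComplexCGF P Y r L where
  integrable_exp z hz := by
    by_contra hint
    exact Complex.exp_ne_zero _ ((h z hz).trans (integral_undef hint))
  analytic := hL
  map_zero := hL0
  exp_eq := h

theorem IsComplexCGF.div_const (hL : IsComplexCGF P Y r L) {σ : ℝ} (hσ : 0 < σ) :
    IsComplexCGF P (fun ω => Y ω / σ) (r * σ) fun z => L ((σ : ℂ)⁻¹ * z) := by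
  have hmaps : Set.MapsTo (fun z : ℂ => (σ : ℂ)⁻¹ * z) (Metric.ball 0 (r * σ))
      (Metric.ball 0 r) := fun z hz => by
    simpa [abs_of_pos hσ, inv_mul_lt_iff₀ hσ, mul_comm σ] using hz
  refine isComplexCGF_of_exp_eq (hL.analytic.comp (fun z _ => by fun_prop) hmaps)
    (by simp [hL.map_zero]) fun z hz => ?_
  rw [hL.exp_eq _ (hmaps hz), complexMGF, complexMGF]
  congr! 3 with ω
  push_cast
  ring

theorem complexMGF_sum_of_iIndepFun {X : ι → Ω → ℝ} (hX : iIndepFun X P)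
    (hXm : ∀ i, AEMeasurable (X i) P) (s : Finset ι) (z : ℂ) :
    complexMGF (fun ω => ∑ i ∈ s, X i ω) P z = ∏ i ∈ s, complexMGF (X i) P z := by
  have hprod := (hX.precomp (g := ((↑) : s → ι)) Subtype.val_injective).integral_fun_prod_comp
    (f := fun _ y => Complex.exp (z * (y : ℝ))) (fun i => hXm i)
    (fun _ => (by fun_prop : Continuous _).aestronglyMeasurable)
  simp only [complexMGF]
  rw [← Finset.prod_coe_sort, ← hprod]
  refine integral_congr_ae (.of_forall fun ω => ?_)
  simp only
  rw [← Complex.exp_sum, Finset.sum_coe_sort s fun i => z * (X i ω : ℂ), ← Finset.mul_sum,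
    Complex.ofReal_sum]

theorem IsComplexCGF.sum {X : ι → Ω → ℝ} {L : ι → ℂ → ℂ} (hL : ∀ i, IsComplexCGF P (X i) r (L i))
    (hr : 0 < r) (hX : iIndepFun X P) (s : Finset ι) :
    IsComplexCGF P (fun ω => ∑ i ∈ s, X i ω) r fun z => ∑ i ∈ s, L i z :=
  isComplexCGF_of_exp_eq (Finset.analyticOnNhd_fun_sum s fun i _ => (hL i).analytic)
    (Finset.sum_eq_zero fun i _ => (hL i).map_zero) fun z hz => by
      rw [complexMGF_sum_of_iIndepFun hX (fun i => (hL i).aemeasurable hr), Complex.exp_sum]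
      exact Finset.prod_congr rfl fun i _ => (hL i).exp_eq z hz

theorem integrable_exp_mul_of_tendsto_mgf {Z : ℕ → Ω → ℝ} {S : Ω → ℝ} {t M : ℝ}
    (hint : ∀ k, Integrable (fun ω => Real.exp (t * Z k ω)) P)
    (hM : Tendsto (fun k => mgf (Z k) P t) atTop (𝓝 M))
    (hZ : ∀ᵐ ω ∂P, Tendsto (fun k => Z k ω) atTop (𝓝 (S ω))) :
    Integrable (fun ω => Real.exp (t * S ω)) P := by
  have hexp : ∀ᵐ ω ∂P, Tendsto (fun k => Real.exp (t * Z k ω)) atTop (𝓝 (Real.exp (t * S ω))) :=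
    hZ.mono fun ω hω => (Real.continuous_exp.tendsto _).comp (hω.const_mul t)
  have hnorm (k : ℕ) : eLpNorm (fun ω => Real.exp (t * Z k ω)) 1 P
      = ENNReal.ofReal (mgf (Z k) P t) := by
    simp [eLpNorm_one_eq_lintegral_enorm, mgf, ofReal_integral_eq_lintegral_ofReal (hint k)
      (.of_forall fun _ => (Real.exp_pos _).le), Real.enorm_of_nonneg (Real.exp_pos _).le]
  refine memLp_one_iff_integrable.1
    ⟨aestronglyMeasurable_of_tendsto_ae atTop (fun k => (hint k).1) hexp, ?_⟩
  calc eLpNorm (fun ω => Real.exp (t * S ω)) 1 P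
      ≤ liminf (fun k => eLpNorm (fun ω => Real.exp (t * Z k ω)) 1 P) atTop :=
        Lp.eLpNorm_lim_le_liminf_eLpNorm (fun k => (hint k).1) _ hexp
    _ = ENNReal.ofReal M := by
        simp only [hnorm]
        exact (ENNReal.tendsto_ofReal hM).liminf_eq
    _ < ⊤ := ENNReal.ofReal_lt_top

theorem tendsto_complexMGF_mul_I [IsFiniteMeasure P] {Z : ℕ → Ω → ℝ} {S : Ω → ℝ}
    (hZm : ∀ k, AEMeasurable (Z k) P) (hZ : ∀ᵐ ω ∂P, Tendsto (fun k => Z k ω) atTop (𝓝 (S ω)))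
    (t : ℝ) : Tendsto (fun k => complexMGF (Z k) P (t * Complex.I)) atTop
      (𝓝 (complexMGF S P (t * Complex.I))) := by
  have hcont : Continuous fun y : ℝ => Complex.exp (t * Complex.I * y) := by fun_prop
  refine tendsto_integral_of_dominated_convergence (fun _ => 1)
    (fun k => (hcont.measurable.comp_aemeasurable (hZm k)).aestronglyMeasurable)
    (integrable_const 1) (fun k => .of_forall fun ω => ?_)
    (hZ.mono fun ω hω => (hcont.tendsto _).comp hω)
  rw [Complex.norm_exp]
  simp

theorem eqOn_ball_of_eq_mul_I {f g : ℂ → ℂ} (hr : 0 < r)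
    (hf : AnalyticOnNhd ℂ f (Metric.ball 0 r)) (hg : AnalyticOnNhd ℂ g (Metric.ball 0 r))
    (hfg : ∀ t : ℝ, |t| < r → f (t * Complex.I) = g (t * Complex.I)) :
    Set.EqOn f g (Metric.ball 0 r) := by
  refine hf.eqOn_of_preconnected_of_frequently_eq hg (convex_ball 0 r).isPreconnected
    (Metric.mem_ball_self hr) ?_
  have htendsto : Tendsto (fun t : ℝ => (t : ℂ) * Complex.I) (𝓝[≠] 0) (𝓝[≠] 0) := by
    refine tendsto_nhdsWithin_of_tendsto_nhds_of_eventually_within _ ?_ ?_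
    · exact ((by fun_prop : Continuous _).tendsto' 0 0 (by simp)).mono_left nhdsWithin_le_nhds
    · filter_upwards [self_mem_nhdsWithin] with t ht
      simpa using ht
  refine htendsto.frequently (Eventually.frequently ?_)
  filter_upwards [nhdsWithin_le_nhds (Metric.ball_mem_nhds 0 hr)] with t ht
  exact hfg t (by simpa using ht)

/- Fatou's lemma makes the exponential moments of `S` finite, so its complex moment generating
function is analytic on the disc. Convergence is only automatic on the imaginary axis, from which
the identity theorem propagates the formula. -/
theorem IsComplexCGF.of_tendsto_ae [IsFiniteMeasure P] {Z : ℕ → Ω → ℝ} {S : Ω → ℝ}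
    {L : ℕ → ℂ → ℂ} {Λ : ℂ → ℂ} (hr : 0 < r) (hL : ∀ k, IsComplexCGF P (Z k) r (L k))
    (hΛ : AnalyticOnNhd ℂ Λ (Metric.ball 0 r))
    (hLΛ : ∀ z ∈ Metric.ball 0 r, Tendsto (fun k => L k z) atTop (𝓝 (Λ z)))
    (hZ : ∀ᵐ ω ∂P, Tendsto (fun k => Z k ω) atTop (𝓝 (S ω))) :
    IsComplexCGF P S r Λ := by
  have hint (t : ℝ) (ht : |t| < r) : Integrable (fun ω => Real.exp (t * S ω)) P := by
    refine integrable_exp_mul_of_tendsto_mgf (M := Real.exp (Λ t).re)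
      (fun k => (hL k).integrable_exp_mul ht) ?_ hZ
    simp only [fun k => (hL k).mgf_eq ht]
    exact (Real.continuous_exp.tendsto _).comp
      ((Complex.continuous_re.tendsto _).comp (hLΛ t (by simpa using ht)))
  have hmgf : AnalyticOnNhd ℂ (complexMGF S P) (Metric.ball 0 r) := fun z hz =>
    analyticAt_complexMGF (mem_interior_integrableExpSet_of_abs_lt hint
      ((Complex.abs_re_le_norm z).trans_lt (by simpa using hz)))
  have hΛ0 : Λ 0 = 0 := tendsto_nhds_unique (hLΛ 0 (Metric.mem_ball_self hr))
    (by simp only [(hL _).map_zero, tendsto_const_nhds])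
  refine isComplexCGF_of_exp_eq hΛ hΛ0 (eqOn_ball_of_eq_mul_I hr hΛ.cexp hmgf fun t ht => ?_)
  have htI : (t : ℂ) * Complex.I ∈ Metric.ball 0 r := by simpa using ht
  refine tendsto_nhds_unique ((Complex.continuous_exp.tendsto _).comp (hLΛ _ htI)) ?_
  simpa only [Function.comp_def, (hL _).exp_eq _ htI] using
    tendsto_complexMGF_mul_I (fun k => (hL k).aemeasurable hr) hZ t

theorem IsComplexCGF.tsum {X : ι → Ω → ℝ} {L : ι → ℂ → ℂ} {c : ι → ℝ} {S : Ω → ℝ}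
    {s : κ → Finset ι} {u : Filter κ} [u.NeBot] [u.IsCountablyGenerated] (hr : 0 < r)
    (hL : ∀ i, IsComplexCGF P (X i) r (L i)) (hX : iIndepFun X P) (hc : Summable c)
    (hLc : ∀ i, ∀ z ∈ Metric.ball (0 : ℂ) r, ‖L i z‖ ≤ c i) (hs : Tendsto s u atTop)
    (hS : TendstoInMeasure P (fun k ω => ∑ i ∈ s k, X i ω) u S) :
    IsComplexCGF P S r fun z => ∑' i, L i z := by
  have := hX.isProbabilityMeasure
  obtain ⟨k, hk, hae⟩ := hS.exists_seq_tendsto_ae'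
  refine .of_tendsto_ae hr (fun n => .sum hL hr hX (s (k n))) ?_ (fun z hz => ?_) hae
  · exact (Complex.differentiableOn_tsum_of_summable_norm hc
      (fun i => (hL i).analytic.differentiableOn) Metric.isOpen_ball hLc).analyticOnNhd
      Metric.isOpen_ball
  · exact (Summable.of_norm_bounded hc fun i => hLc i z hz).hasSum.comp (hs.comp hk)

end ComplexCGFSum

section GaussianRemainder

variable {Ω : Type*} [MeasurableSpace Ω] {P : Measure Ω} {Y : Ω → ℝ} {L : ℂ → ℂ} {A T x : ℝ}

/-- The difference between a cumulant generating function `L` and that of the standard normal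
distribution. -/
noncomputable def gaussianRemainder (L : ℂ → ℂ) (z : ℂ) : ℂ := L z - z ^ 2 / 2

theorem differentiableOn_gaussianRemainder {s : Set ℂ} (hL : DifferentiableOn ℂ L s) :
    DifferentiableOn ℂ (gaussianRemainder L) s :=
  hL.sub (by fun_prop)

theorem IsComplexCGF.iteratedDeriv_gaussianRemainder_eq_zero (hL : IsComplexCGF P Y T L)
    (hT : 0 < T) (h₁ : cumulant P Y 1 = 0) (h₂ : cumulant P Y 2 = 1) (h₃ : cumulant P Y 3 = 0)
    {k : ℕ} (hk : k < 4) : iteratedDeriv k (gaussianRemainder L) 0 = 0 := by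
  have hL0 := hL.analytic 0 (Metric.mem_ball_self hT)
  unfold gaussianRemainder
  rw [iteratedDeriv_fun_sub hL0.contDiffAt (by fun_prop), iteratedDeriv_div_const]
  interval_cases k
  · simp [hL.map_zero]
  all_goals
    rw [hL.iteratedDeriv_zero_eq_cumulant hT]
    simp [h₁, h₂, h₃]

theorem norm_gaussianRemainder_le (hLA : ∀ z ∈ Metric.ball (0 : ℂ) T, ‖L z‖ ≤ A * T ^ 2) :
    ∀ z ∈ Metric.ball (0 : ℂ) T, ‖gaussianRemainder L z‖ ≤ (A + 1 / 2) * T ^ 2 := fun z hz => by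
  have hzT : ‖z‖ ^ 2 ≤ T ^ 2 := by
    gcongr
    exact (mem_ball_zero_iff.1 hz).le
  calc ‖L z - z ^ 2 / 2‖ ≤ ‖L z‖ + ‖z ^ 2 / 2‖ := norm_sub_le _ _
    _ = ‖L z‖ + ‖z‖ ^ 2 / 2 := by simp
    _ ≤ (A + 1 / 2) * T ^ 2 := by linarith [hLA z hz]

theorem norm_gaussianRemainder_le_pow_four (hL : DifferentiableOn ℂ L (Metric.ball 0 T))
    (hLA : ∀ z ∈ Metric.ball (0 : ℂ) T, ‖L z‖ ≤ A * T ^ 2)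
    (hL0 : ∀ k < 4, iteratedDeriv k (gaussianRemainder L) 0 = 0) {z : ℂ}
    (hz : z ∈ Metric.ball 0 T) : ‖gaussianRemainder L z‖ ≤ (A + 1 / 2) / T ^ 2 * ‖z‖ ^ 4 := by
  have hT : 0 < T := Metric.pos_of_mem_ball hz
  calc ‖gaussianRemainder L z‖ ≤ (A + 1 / 2) * T ^ 2 * (‖z - 0‖ / T) ^ 4 :=
        norm_le_mul_pow_of_iteratedDeriv_eq_zero (differentiableOn_gaussianRemainder hL)
          (norm_gaussianRemainder_le hLA) hL0 hz
    _ = (A + 1 / 2) / T ^ 2 * ‖z‖ ^ 4 := by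
        rw [sub_zero]
        field_simp

theorem norm_deriv_gaussianRemainder_le_pow_three (hL : DifferentiableOn ℂ L (Metric.ball 0 T))
    (hLA : ∀ z ∈ Metric.ball (0 : ℂ) T, ‖L z‖ ≤ A * T ^ 2)
    (hL0 : ∀ k < 4, iteratedDeriv k (gaussianRemainder L) 0 = 0) {z : ℂ}
    (hz : z ∈ Metric.ball 0 (T / 2)) :
    ‖deriv (gaussianRemainder L) z‖ ≤ (16 * A + 8) / T ^ 2 * ‖z‖ ^ 3 := by
  have hT : 0 < T := by linarith [Metric.pos_of_mem_ball hz]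
  calc ‖deriv (gaussianRemainder L) z‖
      ≤ (A + 1 / 2) * T ^ 2 / (T / 2) * (‖z - 0‖ / (T / 2)) ^ 3 :=
        norm_deriv_le_mul_pow_of_iteratedDeriv_eq_zero (differentiableOn_gaussianRemainder hL)
          (norm_gaussianRemainder_le hLA) (fun k hk => hL0 (k + 1) (by lia)) hz
    _ = (16 * A + 8) / T ^ 2 * ‖z‖ ^ 3 := by
        rw [sub_zero]
        field_simp
        ring

theorem IsComplexCGF.mgf_eq_exp_gaussianRemainder (hL : IsComplexCGF P Y T L) (hx : |x| < T) :
    mgf Y P x = Real.exp (x ^ 2 / 2 + (gaussianRemainder L x).re) := by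
  have hsq : ((x : ℂ) ^ 2 / 2).re = x ^ 2 / 2 := by norm_cast
  rw [hL.mgf_eq hx, gaussianRemainder, Complex.sub_re, hsq, add_sub_cancel]

theorem IsComplexCGF.charFun_tiltedLaw_eq_exp_gaussianRemainder (hL : IsComplexCGF P Y T L)
    {t : ℝ} (hxt : x + t * Complex.I ∈ Metric.ball 0 T) :
    charFun (tiltedLaw P Y x) t = Complex.exp (-t ^ 2 / 2)
      * Complex.exp (gaussianRemainder L (x + t * Complex.I) - gaussianRemainder L x) := by
  have hx : (x : ℂ) ∈ Metric.ball 0 T := by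
    rw [mem_ball_zero_iff] at hxt ⊢
    rw [Complex.norm_real]
    simpa using (Complex.abs_re_le_norm _).trans_lt hxt
  rw [charFun_tiltedLaw (hL.aemeasurable (Metric.pos_of_mem_ball hxt)), ← complexMGF_ofReal,
    ← hL.exp_eq _ hxt, ← hL.exp_eq _ hx, ← Complex.exp_add, ← Complex.exp_sub, ← Complex.exp_add]
  congr 1
  simp only [gaussianRemainder]
  linear_combination ((t : ℂ) ^ 2 / 2) * Complex.I_sq

end GaussianRemainder

section TiltedLawApproximation

variable {Ω : Type*} [MeasurableSpace Ω] {P : Measure Ω} {Y : Ω → ℝ} {L : ℂ → ℂ}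
  {M T κ x : ℝ}

theorem norm_exp_sub_one_le_mul_exp (z : ℂ) : ‖Complex.exp z - 1‖ ≤ ‖z‖ * Real.exp ‖z‖ := by
  simpa using Complex.norm_exp_sub_sum_le_norm_mul_exp z 1

theorem integrable_add_sq_mul_exp_neg_mul_sq (κ : ℝ) {b : ℝ} (hb : 0 < b) :
    Integrable fun t : ℝ => (κ + t ^ 2) * Real.exp (-b * t ^ 2) := by
  simp only [add_mul]
  refine ((integrable_exp_neg_mul_sq hb).const_mul κ).add ?_
  simpa only [Real.rpow_two] using integrable_rpow_mul_exp_neg_mul_sq hb (s := 2) (by norm_num)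

theorem norm_gaussianRemainder_add_mul_I_sub_le (hL : DifferentiableOn ℂ L (Metric.ball 0 T))
    (hd : ∀ z ∈ Metric.ball (0 : ℂ) (T / 2),
      ‖deriv (gaussianRemainder L) z‖ ≤ M / T ^ 2 * ‖z‖ ^ 3)
    (hM : 0 ≤ M) (hT : 0 < T) (hx : 0 ≤ x) (hxT : x ≤ T / 8) (hxκ : x ^ 3 ≤ κ * T) {t : ℝ}
    (ht : |t| ≤ T / 4) :
    ‖gaussianRemainder L (x + t * Complex.I) - gaussianRemainder L x‖
      ≤ 4 * M / T * (κ + t ^ 2) * |t| := by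
  have hcube : (x + |t|) ^ 3 ≤ 4 * T * (κ + t ^ 2) := by
    have ht3 : |t| ^ 3 ≤ T * t ^ 2 := by
      rw [pow_succ', sq_abs]
      gcongr
      linarith
    calc (x + |t|) ^ 3 ≤ 2 ^ (3 - 1) * (x ^ 3 + |t| ^ 3) := add_pow_le hx (abs_nonneg t) 3
      _ ≤ 2 ^ (3 - 1) * (κ * T + T * t ^ 2) := by gcongr
      _ = 4 * T * (κ + t ^ 2) := by ring
  have hxnorm : ‖(x : ℂ)‖ = x := Complex.norm_of_nonneg hx
  have htnorm : ‖(t : ℂ) * Complex.I‖ = |t| := by simp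
  have hmvt := norm_add_sub_le_of_norm_deriv_le_pow (h := t * Complex.I)
    ((differentiableOn_gaussianRemainder hL).mono (Metric.ball_subset_ball (half_le_self hT.le)))
    (by positivity) hd (z := x) (by rw [hxnorm, htnorm]; linarith)
  rw [hxnorm, htnorm] at hmvt
  calc ‖gaussianRemainder L (x + t * Complex.I) - gaussianRemainder L x‖
      ≤ M / T ^ 2 * (x + |t|) ^ 3 * |t| := hmvt
    _ ≤ M / T ^ 2 * (4 * T * (κ + t ^ 2)) * |t| := by gcongr
    _ = 4 * M / T * (κ + t ^ 2) * |t| := by field_simp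

theorem IsComplexCGF.norm_charFun_tiltedLaw_sub_le (hL : IsComplexCGF P Y T L)
    (hd : ∀ z ∈ Metric.ball (0 : ℂ) (T / 2),
      ‖deriv (gaussianRemainder L) z‖ ≤ M / T ^ 2 * ‖z‖ ^ 3)
    (hM : 0 ≤ M) (hT : 0 < T) (hκ : 0 ≤ κ) (hx : 0 ≤ x) (hxT : x ≤ T / 8) (hxκ : x ^ 3 ≤ κ * T)
    {t : ℝ} (ht : |t| ≤ T / (16 * M + 4)) :
    ‖charFun (tiltedLaw P Y x) t - charFun (gaussianReal 0 1) t‖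
      ≤ |t| * (4 * M * Real.exp (κ / 4) / T * ((κ + t ^ 2) * Real.exp (-(1 / 4) * t ^ 2))) := by
  have htM : |t| * (16 * M + 4) ≤ T := by rwa [le_div_iff₀ (by positivity)] at ht
  have htT : |t| ≤ T / 4 := by nlinarith [abs_nonneg t]
  have hxt : x + t * Complex.I ∈ Metric.ball 0 T := by
    rw [mem_ball_zero_iff]
    calc ‖x + t * Complex.I‖ ≤ ‖(x : ℂ)‖ + ‖t * Complex.I‖ := norm_add_le _ _
      _ = x + |t| := by simp [abs_of_nonneg hx]
      _ < T := by linarith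
  have hgauss : charFun (gaussianReal 0 1) t = Complex.exp (-t ^ 2 / 2) := by
    simp [charFun_gaussianReal, neg_div]
  have hnorm : ‖Complex.exp (-t ^ 2 / 2)‖ = Real.exp (-t ^ 2 / 2) := by
    rw [Complex.norm_exp]
    norm_cast
  rw [hL.charFun_tiltedLaw_eq_exp_gaussianRemainder hxt, hgauss, ← mul_sub_one, norm_mul, hnorm]
  set ρ := gaussianRemainder L (x + t * Complex.I) - gaussianRemainder L x
  have hρ : ‖ρ‖ ≤ 4 * M / T * (κ + t ^ 2) * |t| :=
    norm_gaussianRemainder_add_mul_I_sub_le hL.analytic.differentiableOn hd hM hT hx hxT hxκ htT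
  have hρ' : ‖ρ‖ ≤ κ / 4 + t ^ 2 / 4 := by
    have hMt : 4 * M / T * |t| ≤ 1 / 4 := by
      rw [div_mul_eq_mul_div, div_le_iff₀ hT]
      linarith [abs_nonneg t]
    nlinarith [sq_nonneg t]
  calc Real.exp (-t ^ 2 / 2) * ‖Complex.exp ρ - 1‖
      ≤ Real.exp (-t ^ 2 / 2) * (‖ρ‖ * Real.exp ‖ρ‖) := by
        gcongr
        exact norm_exp_sub_one_le_mul_exp ρ
    _ ≤ Real.exp (-t ^ 2 / 2)
          * (4 * M / T * (κ + t ^ 2) * |t| * Real.exp (κ / 4 + t ^ 2 / 4)) := by gcongr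
    _ = 4 * M / T * (κ + t ^ 2) * |t| * Real.exp (κ / 4 + -(1 / 4) * t ^ 2) := by
        rw [mul_left_comm, ← Real.exp_add]
        ring_nf
    _ = |t| * (4 * M * Real.exp (κ / 4) / T
          * ((κ + t ^ 2) * Real.exp (-(1 / 4) * t ^ 2))) := by
        rw [Real.exp_add]
        ring

theorem exists_abs_cdf_tiltedLaw_sub_cdf_gaussianReal_le (hM : 0 ≤ M) (hκ : 0 ≤ κ) :
    ∃ C : ℝ, ∀ {Ω : Type*} [MeasurableSpace Ω] {P : Measure Ω} [IsProbabilityMeasure P]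
      {Y : Ω → ℝ} {L : ℂ → ℂ} {T x : ℝ}, IsComplexCGF P Y T L → 0 < T →
      (∀ z ∈ Metric.ball (0 : ℂ) (T / 2),
        ‖deriv (gaussianRemainder L) z‖ ≤ M / T ^ 2 * ‖z‖ ^ 3) →
      0 ≤ x → x ≤ T / 8 → x ^ 3 ≤ κ * T →
      ∀ y, |cdf (tiltedLaw P Y x) y - cdf (gaussianReal 0 1) y| ≤ C / T := by
  obtain ⟨C, hC, hsmoothing⟩ := exists_abs_cdf_sub_cdf_le_of_charFun
  have hint := integrable_add_sq_mul_exp_neg_mul_sq κ (b := 1 / 4) (by norm_num)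
  set g : ℝ → ℝ := fun t => (κ + t ^ 2) * Real.exp (-(1 / 4) * t ^ 2)
  have hg (t : ℝ) : 0 ≤ g t := by positivity
  set D := 4 * M * Real.exp (κ / 4)
  have : 0 ≤ D := by positivity
  refine ⟨C * (D * (∫ t, g t) + (16 * M + 4)), fun {Ω _ P _ Y L T x} hL hT hd hx hxT hxκ y => ?_⟩
  have := isProbabilityMeasure_tiltedLaw (hL.aemeasurable hT)
    (hL.integrable_exp_mul (t := x) (by rw [abs_of_nonneg hx]; linarith))
  have hU : 0 < T / (16 * M + 4) := by positivity
  have hle : ∫ t in -(T / (16 * M + 4))..T / (16 * M + 4), D / T * g t ≤ D / T * ∫ t, g t := by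
    rw [intervalIntegral.integral_const_mul, intervalIntegral.integral_of_le (by linarith)]
    exact mul_le_mul_of_nonneg_left (setIntegral_le_integral hint (.of_forall hg)) (by positivity)
  calc |cdf (tiltedLaw P Y x) y - cdf (gaussianReal 0 1) y|
      ≤ C * ((∫ t in -(T / (16 * M + 4))..T / (16 * M + 4), D / T * g t)
          + (1 : NNReal) / (T / (16 * M + 4))) :=
        hsmoothing _ _ 1 _ _ (lipschitzWith_one_cdf_of_le_volume gaussianReal_zero_one_le_volume)
          hU (hint.const_mul _).intervalIntegrable
          (fun t ht => hL.norm_charFun_tiltedLaw_sub_le hd hM hT hκ hx hxT hxκ ht) y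
    _ ≤ C * (D / T * (∫ t, g t) + (1 : NNReal) / (T / (16 * M + 4))) := by gcongr
    _ = C * (D * (∫ t, g t) + (16 * M + 4)) / T := by
        rw [NNReal.coe_one]
        field_simp

end TiltedLawApproximation

section LargeDeviations

theorem abs_sub_exp_mul_le {J J' x ρ ε a Δ : ℝ} (hJ : 0 ≤ J) (hxJ : x * J ≤ 1)
    (hρ : |ρ| ≤ ε * x) (hεa : ε * x ≤ a) (hε : 0 ≤ ε) (hJJ' : |J' - J| ≤ Δ) :
    |J - Real.exp ρ * J'| ≤ Real.exp a * (ε + Δ) := by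
  have hexp : |Real.exp ρ - 1| ≤ ε * x * Real.exp a := by
    have h : |Real.exp ρ - 1| ≤ |ρ| * Real.exp |ρ| := by
      exact_mod_cast norm_exp_sub_one_le_mul_exp ρ
    calc |Real.exp ρ - 1| ≤ |ρ| * Real.exp |ρ| := h
      _ ≤ ε * x * Real.exp a := by
        gcongr
        · exact (abs_nonneg ρ).trans hρ
        · exact hρ.trans hεa
  calc |J - Real.exp ρ * J'| = |(Real.exp ρ - 1) * J + Real.exp ρ * (J' - J)| := by
        rw [← abs_neg]
        ring_nf
    _ ≤ |Real.exp ρ - 1| * J + Real.exp ρ * |J' - J| := by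
        refine (abs_add_le _ _).trans_eq ?_
        rw [abs_mul, abs_mul, abs_of_nonneg hJ, Real.abs_exp]
    _ ≤ ε * x * Real.exp a * J + Real.exp a * Δ := by
        gcongr
        exact (le_abs_self ρ).trans (hρ.trans hεa)
    _ = Real.exp a * (ε * (x * J) + Δ) := by ring
    _ ≤ Real.exp a * (ε + Δ) := by
        gcongr
        exact mul_le_of_le_one_right hε hxJ

theorem stdNormalCDF_eq_one_sub (x : ℝ) :
    stdNormalCDF x = 1 - (gaussianReal 0 1).real (Set.Ici x) := by
  have := nullSingletonClass_gaussianReal (μ := 0) (v := 1) one_ne_zero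
  rw [stdNormalCDF, cdf_eq_real, ← measureReal_congr Iio_ae_eq_Iic, ← Set.compl_Ici,
    probReal_compl_eq_one_sub measurableSet_Ici]

theorem measureReal_lt_sub_stdNormalCDF_eq {Ω : Type*} [MeasurableSpace Ω] {P : Measure Ω}
    [IsProbabilityMeasure P] {Y : Ω → ℝ} {L : ℂ → ℂ} {T x : ℝ} (hL : IsComplexCGF P Y T L)
    (hx : |x| < T) :
    P.real {ω | Y ω < x} - stdNormalCDF x = Real.exp (-x ^ 2 / 2)
      * ((∫ v in Set.Ici 0, Real.exp (-(x * v)) ∂(gaussianReal 0 1))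
        - Real.exp (gaussianRemainder L x).re
          * ∫ v in Set.Ici 0, Real.exp (-(x * v)) ∂(tiltedLaw P Y x)) := by
  have hY : AEMeasurable Y P := hL.aemeasurable ((abs_nonneg x).trans_lt hx)
  have hcompl : P.real {ω | Y ω < x} = 1 - P.real {ω | x ≤ Y ω} := by
    rw [← probReal_compl_eq_one_sub₀ (nullMeasurableSet_le aemeasurable_const hY)]
    simp only [Set.compl_ofPred, not_le]
  have hexp : Real.exp (x ^ 2 / 2 + (gaussianRemainder L x).re) * Real.exp (-x ^ 2)
      = Real.exp (-x ^ 2 / 2) * Real.exp (gaussianRemainder L x).re := by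
    rw [← Real.exp_add, ← Real.exp_add]
    ring_nf
  rw [hcompl, measureReal_le_eq_mgf_mul_setIntegral_tiltedLaw hY (hL.integrable_exp_mul hx),
    hL.mgf_eq_exp_gaussianRemainder hx, hexp, stdNormalCDF_eq_one_sub,
    measureReal_gaussianReal_Ici]
  ring

theorem abs_re_gaussianRemainder_le {L : ℂ → ℂ} {A T κ x : ℝ}
    (hL : DifferentiableOn ℂ L (Metric.ball 0 T))
    (hLA : ∀ z ∈ Metric.ball (0 : ℂ) T, ‖L z‖ ≤ A * T ^ 2)
    (hL0 : ∀ k < 4, iteratedDeriv k (gaussianRemainder L) 0 = 0) (hA : 0 ≤ A) (hx : 0 ≤ x)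
    (hxT : x < T) (hxκ : x ^ 3 ≤ κ * T) :
    |(gaussianRemainder L x).re| ≤ (A + 1 / 2) * κ / T * x := by
  have hT : 0 < T := hx.trans_lt hxT
  calc |(gaussianRemainder L x).re| ≤ ‖gaussianRemainder L x‖ := Complex.abs_re_le_norm _
    _ ≤ (A + 1 / 2) / T ^ 2 * ‖(x : ℂ)‖ ^ 4 :=
      norm_gaussianRemainder_le_pow_four hL hLA hL0 (by simpa [abs_of_nonneg hx])
    _ = (A + 1 / 2) / T ^ 2 * (x ^ 3 * x) := by rw [Complex.norm_of_nonneg hx, pow_succ x]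
    _ ≤ (A + 1 / 2) / T ^ 2 * (κ * T * x) := by gcongr
    _ = (A + 1 / 2) * κ / T * x := by field_simp

theorem exists_abs_measureReal_lt_sub_stdNormalCDF_le {A κ : ℝ} (hA : 0 ≤ A) (hκ : 0 ≤ κ) :
    ∃ C : ℝ, ∀ {Ω : Type*} [MeasurableSpace Ω] {P : Measure Ω} [IsProbabilityMeasure P]
      {Y : Ω → ℝ} {L : ℂ → ℂ} {T x : ℝ}, IsComplexCGF P Y T L → 0 < T →
      (∀ z ∈ Metric.ball (0 : ℂ) T, ‖L z‖ ≤ A * T ^ 2) →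
      cumulant P Y 1 = 0 → cumulant P Y 2 = 1 → cumulant P Y 3 = 0 →
      0 ≤ x → x ≤ T / 8 → x ^ 3 ≤ κ * T →
      |P.real {ω | Y ω < x} - stdNormalCDF x| ≤ C * (Real.exp (-x ^ 2 / 2) / T) := by
  obtain ⟨C, hcdf⟩ := exists_abs_cdf_tiltedLaw_sub_cdf_gaussianReal_le
    (M := 16 * A + 8) (by positivity) hκ
  set a := (A + 1 / 2) * κ
  refine ⟨Real.exp a * (a + 2 * C), fun {Ω _ P _ Y L T x} hL hT hLA h₁ h₂ h₃ hx hxT hxκ => ?_⟩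
  have hL0 : ∀ k < 4, iteratedDeriv k (gaussianRemainder L) 0 = 0 := fun k hk =>
    hL.iteratedDeriv_gaussianRemainder_eq_zero hT h₁ h₂ h₃ hk
  have hxT' : |x| < T := by
    rw [abs_of_nonneg hx]
    linarith
  have hρ : |(gaussianRemainder L x).re| ≤ a / T * x :=
    abs_re_gaussianRemainder_le hL.analytic.differentiableOn hLA hL0 hA hx
      ((le_abs_self x).trans_lt hxT') hxκ
  have hxa : a / T * x ≤ a := by
    rw [div_mul_eq_mul_div, div_le_iff₀ hT]
    gcongr
    linarith
  have := isProbabilityMeasure_tiltedLaw (hL.aemeasurable hT) (hL.integrable_exp_mul hxT')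
  rw [measureReal_lt_sub_stdNormalCDF_eq hL hxT', abs_mul, Real.abs_exp]
  calc _ ≤ Real.exp (-x ^ 2 / 2) * (Real.exp a * (a / T + 2 * (C / T))) := by
        gcongr
        exact abs_sub_exp_mul_le
          (setIntegral_nonneg measurableSet_Ici fun v _ => (Real.exp_pos _).le)
          (mul_setIntegral_exp_neg_mul_le_one_of_le_volume gaussianReal_zero_one_le_volume hx)
          hρ hxa (by positivity) (abs_setIntegral_exp_neg_mul_sub_le
            (hcdf hL hT (fun z => norm_deriv_gaussianRemainder_le_pow_three
              hL.analytic.differentiableOn hLA hL0) hx hxT hxκ) hx)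
    _ = Real.exp a * (a + 2 * C) * (Real.exp (-x ^ 2 / 2) / T) := by ring

end LargeDeviations

section NormalizedSum

variable {Ω ι : Type*} [MeasurableSpace Ω] {P : Measure Ω}

theorem cumulant_div_const (Y : Ω → ℝ) (σ : ℝ) (k : ℕ) :
    cumulant P (fun ω => Y ω / σ) k = cumulant P Y k / σ ^ k := by
  have hcgf : cgf (fun ω => Y ω / σ) P = fun t => cgf Y P (σ⁻¹ * t) := by
    ext t
    simp only [cgf, mgf, div_eq_inv_mul, mul_left_comm t, mul_assoc]
  rw [cumulant, hcgf, iteratedDeriv_comp_mul_left]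
  simp only [cumulant, mul_zero, smul_eq_mul, inv_pow, inv_mul_eq_div]

theorem IsComplexCGF.hasSum_cumulant {X : ι → Ω → ℝ} {S : Ω → ℝ} {r : ℝ} {L : ι → ℂ → ℂ}
    {c : ι → ℝ} (hS : IsComplexCGF P S r fun z => ∑' i, L i z) (hr : 0 < r)
    (hL : ∀ i, IsComplexCGF P (X i) r (L i)) (hc : Summable c)
    (hLc : ∀ i, ∀ z ∈ Metric.ball (0 : ℂ) r, ‖L i z‖ ≤ c i) (k : ℕ) :
    HasSum (fun i => cumulant P (X i) k) (cumulant P S k) := by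
  have h := hasSum_iteratedDeriv_tsum hr hc (fun i => (hL i).analytic.differentiableOn) hLc k
  rw [hS.iteratedDeriv_zero_eq_cumulant hr] at h
  simpa only [(hL _).iteratedDeriv_zero_eq_cumulant hr, Complex.hasSum_ofReal] using h

theorem normalizedCDF_eq_measureReal_div_lt (S : Ω → ℝ) {B : ℝ} (hB : 0 < B) (x : ℝ) :
    normalizedCDF P S B x = P.real {ω | S ω / √B < x} := by
  simp only [normalizedCDF, div_lt_iff₀ (Real.sqrt_pos.2 hB)]

theorem exists_abs_normalizedCDF_sub_stdNormalCDF_le {A κ : ℝ} (hA : 0 ≤ A) (hκ : 0 ≤ κ) :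
    ∃ C : ℝ, ∀ {Ω : Type*} [MeasurableSpace Ω] {P : Measure Ω} [IsProbabilityMeasure P]
      {S : Ω → ℝ} {L : ℂ → ℂ} {H B x : ℝ}, IsComplexCGF P S H L → 0 < H → 0 < B →
      (∀ z ∈ Metric.ball (0 : ℂ) H, ‖L z‖ ≤ A * (B * H ^ 2)) →
      cumulant P S 1 = 0 → cumulant P S 2 = B → cumulant P S 3 = 0 →
      0 ≤ x → x ≤ H * √B / 8 → x ^ 3 ≤ κ * (H * √B) →
      |normalizedCDF P S B x - stdNormalCDF x| ≤ C * (Real.exp (-x ^ 2 / 2) / (H * √B)) := by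
  obtain ⟨C, hC⟩ := exists_abs_measureReal_lt_sub_stdNormalCDF_le hA hκ
  refine ⟨C, fun {Ω _ P _ S L H B x} hL hH hB hLA h₁ h₂ h₃ hx hxT hxκ => ?_⟩
  have hσ : 0 < √B := Real.sqrt_pos.2 hB
  rw [normalizedCDF_eq_measureReal_div_lt S hB]
  refine hC (hL.div_const hσ) (by positivity) (fun z hz => ?_) ?_ ?_ ?_ hx hxT hxκ
  · rw [mul_pow, Real.sq_sqrt hB.le, mul_comm (H ^ 2)]
    refine hLA _ ?_
    simpa [abs_of_pos hσ, inv_mul_lt_iff₀ hσ, mul_comm H] using hz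
  all_goals rw [cumulant_div_const]
  · rw [h₁, zero_div]
  · rw [h₂, Real.sq_sqrt hB.le, div_self hB.ne']
  · rw [h₃, zero_div]

theorem pow_three_le_of_le_mul_rpow {x K T : ℝ} (hx : 0 ≤ x) (hT : 0 ≤ T)
    (hxK : x ≤ K * T ^ ((1 : ℝ) / 3)) : x ^ 3 ≤ |K| ^ 3 * T :=
  calc x ^ 3 ≤ (|K| * T ^ ((1 : ℝ) / 3)) ^ 3 := by
        gcongr
        exact hxK.trans (by gcongr; exact le_abs_self K)
    _ = |K| ^ 3 * T := by
        rw [mul_pow, ← Real.rpow_mul_natCast hT]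
        norm_num

theorem le_div_eight_of_pow_three_le {x κ T : ℝ} (hT : 0 ≤ T) (hxκ : x ^ 3 ≤ κ * T)
    (hκT : 512 * κ ≤ T ^ 2) : x ≤ T / 8 := by
  refine le_of_pow_le_pow_left₀ three_ne_zero (by positivity) ?_
  calc x ^ 3 ≤ κ * T := hxκ
    _ ≤ T ^ 2 / 512 * T := by
        gcongr
        linarith
    _ = (T / 8) ^ 3 := by ring

end NormalizedSum

theorem mainTheorem5_general {α : Type*} {l : Filter α} {Ω ι : α → Type*}
    [∀ a, MeasurableSpace (Ω a)] (P : ∀ a, Measure (Ω a)) (X : ∀ a, ι a → Ω a → ℝ)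
    (s : ∀ a, ℕ → Finset (ι a)) (S : ∀ a, Ω a → ℝ) (H B : α → ℝ) (L : ∀ a, ι a → ℂ → ℂ)
    (c : ∀ a, ι a → ℝ) (hX_mean : ∀ a, ∑' j, ∫ ω, X a j ω ∂P a = 0)
    (hX_indep : ∀ a, iIndepFun (X a) (P a)) (hH : ∀ a, 0 < H a)
    (hL : ∀ a j, IsComplexCGF (P a) (X a j) (H a) (L a j))
    (hB : ∀ a, B a = ∑' j, Var[X a j; P a])
    (hs : ∀ a, Tendsto (s a) atTop atTop)
    (hS : ∀ a, TendstoInMeasure (P a) (fun m ω => ∑ j ∈ s a m, X a j ω) atTop (S a))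
    (hLc : ∀ a j, ∀ z ∈ Metric.ball (0 : ℂ) (H a), ‖L a j z‖ ≤ c a j)
    (hBH : Tendsto (fun a => B a * H a ^ 2) l atTop)
    (hc_sum : ∀ a, Summable (c a))
    (hC : (fun a => ∑' j, c a j) =O[l] fun a => B a * H a ^ 2)
    (hγ : ∀ a, ∑' j, cumulant (P a) (X a j) 3 = 0) (K : ℝ) :
    ∃ C : ℝ, ∀ᶠ a in l, ∀ x : ℝ, 0 ≤ x → x ≤ K * (H a * √(B a)) ^ ((1 : ℝ) / 3) →
      |normalizedCDF (P a) (S a) (B a) x - stdNormalCDF x| ≤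
        C * (Real.exp (-x ^ 2 / 2) / (H a * √(B a))) := by
  obtain ⟨A, hA, hCA⟩ := hC.exists_nonneg
  obtain ⟨C, hmain⟩ := exists_abs_normalizedCDF_sub_stdNormalCDF_le hA
    (pow_nonneg (abs_nonneg K) 3)
  refine ⟨C, ?_⟩
  filter_upwards [hCA.bound, hBH.eventually_ge_atTop (512 * |K| ^ 3), hBH.eventually_gt_atTop 0]
    with a hcA hKT hpos x hx hxK
  have := (hX_indep a).isProbabilityMeasure
  have hB0 : 0 < B a := pos_of_mul_pos_left hpos (sq_nonneg _)
  have hT : 0 ≤ H a * √(B a) := mul_nonneg (hH a).le (Real.sqrt_nonneg _)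
  have hxκ := pow_three_le_of_le_mul_rpow hx hT hxK
  have hCGF := IsComplexCGF.tsum (hH a) (hL a) (hX_indep a) (hc_sum a) (hLc a) (hs a) (hS a)
  have hcum := hCGF.hasSum_cumulant (hH a) (hL a) (hc_sum a) (hLc a)
  refine hmain hCGF (hH a) hB0 (fun z hz => ?_) ?_ ?_ ?_ hx
    (le_div_eight_of_pow_three_le hT hxκ ?_) hxκ
  · refine (tsum_of_norm_bounded (hc_sum a).hasSum fun j => hLc a j z hz).trans ?_
    simpa only [Real.norm_of_nonneg hpos.le] using (le_abs_self _).trans hcA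
  · simp only [← (hcum 1).tsum_eq, (hL a _).cumulant_one (hH a), hX_mean]
  · simp only [← (hcum 2).tsum_eq, (hL a _).cumulant_two (hH a), hB]
  · rw [← (hcum 3).tsum_eq, hγ]
  · rwa [mul_pow, Real.sq_sqrt hB0.le, mul_comm (H a ^ 2)]

theorem tendsto_latticeCube (d : ℕ) : Tendsto (latticeCube d) atTop atTop := by
  refine tendsto_atTop_finset_of_monotone (fun m n hmn => ?_) fun j => ?_
  · have hmn' : (m : ℤ) ≤ n := by exact_mod_cast hmn
    exact Finset.Icc_subset_Icc (fun _ => neg_le_neg hmn') fun _ => hmn'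
  · have hj (i : Fin d) : |j i| ≤ ((∑ k, (j k).natAbs : ℕ) : ℤ) := by
      rw [Int.abs_eq_natAbs]
      exact_mod_cast Finset.single_le_sum (f := fun k => (j k).natAbs) (fun _ _ => Nat.zero_le _)
        (Finset.mem_univ i)
    exact ⟨_, Finset.mem_Icc.2 ⟨fun i => (abs_le.1 (hj i)).1, fun i => (abs_le.1 (hj i)).2⟩⟩

theorem mainTheorem5 {Ω : Type*} [MeasurableSpace Ω] (P : Measure Ω) [IsProbabilityMeasure P]
    (d : ℕ) (X : ℕ → (Fin d → ℤ) → Ω → ℝ) (S : ℕ → Ω → ℝ) (H : ℕ → ℝ)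
    (L : ℕ → (Fin d → ℤ) → ℂ → ℂ) (c : ℕ → (Fin d → ℤ) → ℝ)
    (hX_meas : ∀ n j, Measurable (X n j))
    (hX_mean : ∀ n j, ∫ ω, X n j ω ∂P = 0)
    (hX_indep : ∀ n, iIndepFun (X n) P)
    (hH : ∀ n, 0 < H n)
    (hL : ∀ n j, IsComplexCGF P (X n j) (H n) (L n j))
    (hB : ∀ n, Summable fun j => Var[X n j; P])
    (hS : ∀ n, IsFieldSum P (X n) (S n))
    (hc_nonneg : ∀ n j, 0 ≤ c n j)
    (hLc : ∀ n j, ∀ z ∈ Metric.ball (0 : ℂ) (H n), ‖L n j z‖ ≤ c n j)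
    (hBH : Tendsto (fun n => fieldVariance P (X n) * H n ^ 2) atTop atTop)
    (hc_sum : ∀ n, Summable (c n))
    (hC : (fun n => ∑' j, c n j) =O[atTop] fun n => fieldVariance P (X n) * H n ^ 2)
    (hγ : ∀ n, ∑' j, cumulant P (X n j) 3 = 0) :
    ∀ K : ℝ, ∃ C : ℝ, ∀ᶠ n in atTop, ∀ x : ℝ, 0 ≤ x →
      x ≤ K * (H n * √(fieldVariance P (X n))) ^ ((1 : ℝ) / 3) →
      |normalizedCDF P (S n) (fieldVariance P (X n)) x - stdNormalCDF x| ≤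
        C * (Real.exp (-x ^ 2 / 2) / (H n * √(fieldVariance P (X n)))) := by
  exact mainTheorem5_general (fun _ => P) X (fun _ => latticeCube d) S H
    (fun n => fieldVariance P (X n)) L c (fun n => by simp [hX_mean]) hX_indep hH hL (fun _ => rfl)
    (fun _ => tendsto_latticeCube d) hS hLc hBH hc_sum hC hγ
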